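/- Let $\alpha>0$. For each $n\in\mathbb N$ let $\Sigma_n=(\rho^{(n)}_{ij})_{1\le i,j\le n}$ be a correlation matrix (symmetric, positive semidefinite, unit diagonal), and suppose that for some $\beta>0$ the correlations are $O(n^{-\beta})$ uniformly: there is a constant $C$ such that, for all large $n$, $|\rho^{(n)}_{ij}|\le C n^{-\beta}$ for all $i\ne j$ (the "nearly independent setup"). Let $\Phi$ be the standard normal distribution function and let $c_n\in\mathbb R$ be thresholds with $n\,\Phi(-c_n)\to\alpha$ as $n\to\infty$. For a correlation matrix $\Sigma$ of size $n$ put $$\mathrm{FWER}_n(\Sigma)=P\Big(\bigcup_{i=1}^n\{X_i>c_n\}\Big),\qquad X\sim N_n(0,\Sigma),$$ let $I_n$ be the identity matrix (independence), and let $$\bar\rho_n=\frac1{n(n-1)}\sum_{i\ne j}\rho^{(n)}_{ij},\qquad \overline{|\rho|}_n=\frac1{n(n-1)}\sum_{i\ne j}|\rho^{(n)}_{ij}|,$$ $$M_K=\sum_{i=1}^K\frac{(-1)^{i-1}\alpha^i}{i!},\qquad D_{K,n}=\frac{c_n^2\,\bar\rho_n}{2}\sum_{i=2}^K\frac{(-1)^{i-1}\alpha^i}{(i-2)!}.$$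 Then $M_K+D_{K,n}$ approximates $\mathrm{FWER}_n(\Sigma_n)$, with $D_{K,n}$ as the correction factor for the deviation from independence, in the following sense. (1) For every $\varepsilon>0$ there is a $K_0$, depending only on $\alpha$ and $\varepsilon$, such that for every fixed $K\ge K_0$ and all $\beta$, $(\Sigma_n)$, $(c_n)$ as above, for all sufficiently large $n$, $$\left|\frac{\mathrm{FWER}_n(\Sigma_n)}{M_K+D_{K,n}}-1\right|\le\varepsilon .$$ (2) For every fixed $K\ge1$ and all $\beta$, $(\Sigma_n)$, $(c_n)$ as above, for all sufficiently large $n$, $$\big|\mathrm{FWER}_n(\Sigma_n)-(M_K+D_{K,n})\big|\le\frac{\alpha^{K+1}}{(K+1)!}$$ and $$\big|\mathrm{FWER}_n(\Sigma_n)-\mathrm{FWER}_n(I_n)-D_{K,n}\big|\le\frac{c_n^2\,\overline{|\rho|}_n}{2}\cdot\frac{\alpha^{K+1}}{(K-1)!}.$$ -/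

import Mathlib

open MeasureTheory ProbabilityTheory Filter Topology

noncomputable section

/-- A correlation matrix: symmetric, positive semidefinite, with unit diagonal. -/
structure IsCorrelationMatrix {n : ℕ} (S : Matrix (Fin n) (Fin n) ℝ) : Prop where
  posSemidef : S.PosSemidef
  diag_eq_one : ∀ i, S i i = 1

/-- The nearly independent setup with exponent `β`: for each number `n` of hypotheses a correlation
matrix `S n`, whose off-diagonal entries are `O(n ^ (-β))` as `n → ∞`, uniformly in the entry. -/
structure NearlyIndependent (β : ℝ) (S : (n : ℕ) → Matrix (Fin n) (Fin n) ℝ) : Prop where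
  isCorrelationMatrix : ∀ n, IsCorrelationMatrix (S n)
  isBigO : ∃ C : ℝ, ∀ᶠ n : ℕ in atTop, ∀ i j : Fin n, i ≠ j → |S n i j| ≤ C * (n : ℝ) ^ (-β)

/-- Thresholds `c n` of Bonferroni type for level `α`: `n * Φ(-c n) → α`, where `Φ` is the standard
normal distribution function. -/
def BonferroniThresholds (α : ℝ) (c : ℕ → ℝ) : Prop :=
  Tendsto (fun n : ℕ ↦ (n : ℝ) * cdf (gaussianReal 0 1) (-(c n))) atTop (𝓝 α)

/-- The family-wise error rate: the probability that some coordinate of a centered Gaussian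
vector with covariance matrix `S` exceeds `c`. -/
def fwer {n : ℕ} (S : Matrix (Fin n) (Fin n) ℝ) (c : ℝ) : ℝ :=
  (multivariateGaussian 0 S).real {x : EuclideanSpace ℝ (Fin n) | ∃ i, c < x i}

/-- The mean of the off-diagonal entries. -/
def meanCorr {n : ℕ} (S : Matrix (Fin n) (Fin n) ℝ) : ℝ :=
  (∑ i, ∑ j with j ≠ i, S i j) / ((n : ℝ) * ((n : ℝ) - 1))

/-- The mean of the absolute values of the off-diagonal entries. -/
def meanAbsCorr {n : ℕ} (S : Matrix (Fin n) (Fin n) ℝ) : ℝ :=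
  (∑ i, ∑ j with j ≠ i, |S i j|) / ((n : ℝ) * ((n : ℝ) - 1))

/-- The main term `∑_{i=1}^K (-1)^(i-1) α^i / i!`. -/
def mainTerm (α : ℝ) (K : ℕ) : ℝ :=
  ∑ i ∈ Finset.Icc 1 K, (-1 : ℝ) ^ (i - 1) * α ^ i / (i.factorial : ℝ)

/-- The correction term `(c² ρ̄ / 2) ∑_{i=2}^K (-1)^(i-1) α^i / (i-2)!`. -/
def correctionTerm (α : ℝ) (K : ℕ) {n : ℕ} (S : Matrix (Fin n) (Fin n) ℝ) (c : ℝ) : ℝ :=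
  c ^ 2 * meanCorr S / 2 *
    ∑ i ∈ Finset.Icc 2 K, (-1 : ℝ) ^ (i - 1) * α ^ i / ((i - 2).factorial : ℝ)

end

/-!
The complement of the family-wise error rate is the orthant probability `P(X_i ≤ c_n for all i)`.
The main point is its first-order dependence on the correlations, with an error that is small
relative to `∑ |ρ_ij|`, however small these correlations are: Bonferroni-type inequalities cannot
give that, but the derivative along the segment `S_t = I + t (S - I)` does.

For a product of Schwartz functions of the coordinates, Fourier inversion expresses the Gaussian
expectation through `exp (-2π² w·S_t w)`. Differentiating in `t` brings down the off-diagonal part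
of the quadratic form, and each factor `w_i w_j` differentiates two factors of the product
(`exists_integral_prod_sub_eq`). Applied to smooth truncated approximations of the indicator of
`(-∞, c]`, this reduces the change of the orthant probability to the pair integrals
`E[G'(X_i) G'(X_j) ∏ G(X_k)]`, uniformly in `t` (`abs_orthantProb_sub_le`).

A pair integral is approximately the joint density of `(X_i, X_j)` at `(c, c)` times a conditional
orthant probability. When `c² max |ρ_ij|` is small, the density is `φ(c)² (1 + o(1))`, and
regression on the two coordinates turns the conditional probability into an orthant probability
with thresholds moved by `o(1 / c)` (`pairIntegral_bounds`). Bounding the conditional probability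
by a constant already shows that orthant probabilities converge to `e^{-α}`, as under independence;
since `nΦ(-c_n) → α` is stable under moving the thresholds by `o(1 / c_n)`, this limit can be put
back into the pair integrals, which are therefore `φ(c_n)² e^{-α} (1 + o(1))`
(`BonferroniThresholds.eventually_abs_orthantProb_sub_one_le`).

By the Mills ratio, `n² φ(c_n)² ~ α² c_n²`, so the deviation from independence is
`-(c_n² / 2) α² (e^{-α} ρ̄_n + o(1) |ρ|‾_n)`, where `|ρ|‾_n` is the mean absolute correlation. The
main term and the correction term replace `e^{-α}` by partial sums of its alternating series. The
remainders of this series are strictly smaller than the first omitted term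
(`abs_exp_neg_sub_expNegSum_lt`), which leaves room for all the `o(1)` errors.
-/

open scoped SchwartzMap FourierTransform Matrix ContDiff

/-! ### Gaussian interpolation by Fourier inversion -/

/-- A product over all indices whose factors at `i` and `j` are exceptional. -/
lemma Finset.prod_ite_pair {ι M : Type*} [Fintype ι] [DecidableEq ι] [CommMonoid M] {i j : ι}
    (hij : i ≠ j) (a b : ι → M) :
    ∏ k, (if k = i ∨ k = j then a k else b k) = a i * a j * ∏ k ∈ ({i, j} : Finset ι)ᶜ, b k := by
  rw [← Finset.prod_mul_prod_compl ({i, j} : Finset ι), Finset.prod_pair hij]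
  congr 1
  · simp
  · refine Finset.prod_congr rfl fun k hk ↦ ?_
    simp only [Finset.mem_compl, Finset.mem_insert, Finset.mem_singleton] at hk
    rw [if_neg hk]

section Interpolation

variable {ι : Type*} [DecidableEq ι]

/-- `S_t = I + t (S - I)`, the segment from the identity matrix to `S`. -/
noncomputable def interpMatrix (S : Matrix ι ι ℝ) (t : ℝ) : Matrix ι ι ℝ := 1 + t • (S - 1)

lemma interpMatrix_posSemidef {S : Matrix ι ι ℝ} (hS : S.PosSemidef) {t : ℝ} (h0 : 0 ≤ t)
    (h1 : t ≤ 1) : (interpMatrix S t).PosSemidef := by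
  have h : interpMatrix S t = (1 - t) • (1 : Matrix ι ι ℝ) + t • S := by
    rw [interpMatrix, smul_sub, sub_smul, one_smul]; abel
  rw [h]
  exact (Matrix.PosSemidef.one.smul (sub_nonneg.2 h1)).add (hS.smul h0)

@[simp] lemma interpMatrix_zero (S : Matrix ι ι ℝ) : interpMatrix S 0 = 1 := by simp [interpMatrix]

@[simp] lemma interpMatrix_one (S : Matrix ι ι ℝ) : interpMatrix S 1 = S := by simp [interpMatrix]

lemma interpMatrix_apply_ne (S : Matrix ι ι ℝ) (t : ℝ) {i j : ι} (h : i ≠ j) :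
    interpMatrix S t i j = t * S i j := by simp [interpMatrix, h]

lemma interpMatrix_apply_self {S : Matrix ι ι ℝ} (t : ℝ) {i : ι} (h : S i i = 1) :
    interpMatrix S t i i = 1 := by simp [interpMatrix, h]

end Interpolation

section Fourier

lemma integrable_prod_fourier {ι : Type*} [Fintype ι] (g : ι → 𝓢(ℝ, ℂ)) :
    Integrable (fun w : ι → ℝ ↦ ∏ k, 𝓕 (g k) (w k)) :=
  Integrable.fintype_prod (f := fun k v ↦ 𝓕 (g k) v) fun k ↦ (𝓕 (g k)).integrable

lemma continuous_prod_fourier {ι : Type*} [Fintype ι] (g : ι → 𝓢(ℝ, ℂ)) :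
    Continuous (fun w : ι → ℝ ↦ ∏ k, 𝓕 (g k) (w k)) :=
  continuous_finsetProd _ fun k _ ↦ (𝓕 (g k)).continuous.comp (continuous_apply k)

variable {ι : Type*} [Fintype ι] [DecidableEq ι]

/-- The Gaussian expectation of a product of Schwartz functions of the coordinates, in terms of
their Fourier transforms. -/
lemma integral_prod_multivariateGaussian {S : Matrix ι ι ℝ} (hS : S.PosSemidef)
    (g : ι → 𝓢(ℝ, ℂ)) :
    ∫ x, ∏ k, g k (x k) ∂(multivariateGaussian 0 S) =
      ∫ w : ι → ℝ, (∏ k, 𝓕 (g k) (w k)) *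
        Complex.exp (-(2 * Real.pi ^ 2 * (w ⬝ᵥ S *ᵥ w) : ℝ)) := by
  have h1 (x : EuclideanSpace ℝ ι) : ∏ k, g k (x k) =
      ∫ w : ι → ℝ, (∏ k, 𝓕 (g k) (w k)) *
        ∏ k, Complex.exp ((2 * Real.pi * (w k * x k) : ℝ) * Complex.I) := by
    simp_rw [← Finset.prod_mul_distrib]
    rw [integral_fintype_prod_volume_eq_prod (f := fun k v ↦ 𝓕 (g k) v *
      Complex.exp ((2 * Real.pi * (v * x k) : ℝ) * Complex.I))]
    refine Finset.prod_congr rfl fun k _ ↦ ?_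
    conv_lhs => rw [← FourierTransform.fourierInv_fourier_eq (F := 𝓢(ℝ, ℂ)) (g k)]
    rw [SchwartzMap.fourierInv_coe, Real.fourierInv_eq']
    refine integral_congr_ae (.of_forall fun v ↦ ?_)
    simp [mul_comm]
  simp_rw [h1]
  rw [integral_integral_swap]
  · refine integral_congr_ae (.of_forall fun w ↦ ?_)
    simp only
    rw [integral_const_mul]
    congr 1
    -- the remaining integral is the characteristic function at `2πw`
    have h2 := charFun_multivariateGaussian (μ := 0) hS (WithLp.toLp 2 ((2 * Real.pi) • w))
    rw [charFun_apply] at h2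
    convert h2 using 1
    · refine integral_congr_ae (.of_forall fun x ↦ ?_)
      simp only
      rw [← Complex.exp_sum, ← Finset.sum_mul]
      congr 2
      simp only [PiLp.inner_apply]
      push_cast
      refine Finset.sum_congr rfl fun k _ ↦ ?_
      simp
      ring
    · congr 1
      simp only [inner_zero_right, Matrix.mulVec_smul, dotProduct_smul, smul_dotProduct,
        smul_eq_mul]
      push_cast
      ring
  · refine Integrable.mono' ((integrable_prod_fourier g).norm.comp_snd _) ?_ (.of_forall fun z ↦ ?_)
    · refine Continuous.aestronglyMeasurable ?_
      exact ((continuous_prod_fourier g).comp continuous_snd).mul (by fun_prop)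
    · simp only [Function.uncurry]
      rw [norm_mul, norm_prod _ (fun k ↦ Complex.exp _)]
      simp only [Complex.norm_exp_ofReal_mul_I]
      simp

lemma fourier_derivCLM (f : 𝓢(ℝ, ℂ)) (v : ℝ) :
    𝓕 (SchwartzMap.derivCLM ℂ ℂ f) v = (2 * Real.pi * Complex.I * v) * 𝓕 f v := by
  have h : ⇑(SchwartzMap.derivCLM ℂ ℂ f) = deriv f :=
    funext fun x ↦ SchwartzMap.derivCLM_apply ℂ f x
  have h2 := Real.fourier_deriv (f := f) f.integrable f.differentiable
    (h ▸ (SchwartzMap.derivCLM ℂ ℂ f).integrable)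
  rw [SchwartzMap.fourier_coe, h, h2, SchwartzMap.fourier_coe]
  simp

lemma dotProduct_interpMatrix (S : Matrix ι ι ℝ) (t : ℝ) (w : ι → ℝ) :
    w ⬝ᵥ interpMatrix S t *ᵥ w = w ⬝ᵥ w + t * (w ⬝ᵥ (S - 1) *ᵥ w) := by
  simp [interpMatrix, Matrix.add_mulVec, Matrix.smul_mulVec, dotProduct_add]

/-- `f'` at the coordinates `i`, `j` and `f` at the others. -/
noncomputable def derivAt (f : 𝓢(ℝ, ℂ)) (i j k : ι) : 𝓢(ℝ, ℂ) :=
  if k = i ∨ k = j then SchwartzMap.derivCLM ℂ ℂ f else f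

lemma prod_fourier_derivAt (f : 𝓢(ℝ, ℂ)) {i j : ι} (hij : i ≠ j) (w : ι → ℝ) :
    ∏ k, 𝓕 (derivAt f i j k) (w k) = -(4 * Real.pi ^ 2 * w i * w j) * ∏ k, 𝓕 f (w k) := by
  have h (k : ι) : 𝓕 (derivAt f i j k) (w k) =
      (if k = i ∨ k = j then (2 * Real.pi * Complex.I * w k) else 1) * 𝓕 f (w k) := by
    unfold derivAt
    split_ifs with hk
    · exact fourier_derivCLM f (w k)
    · simp
  simp_rw [h, Finset.prod_mul_distrib]
  rw [Finset.prod_ite_pair hij (fun k ↦ 2 * Real.pi * Complex.I * (w k : ℂ)) (fun _ ↦ 1)]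
  congr 1
  simp only [Finset.prod_const_one, mul_one]
  linear_combination 4 * Real.pi ^ 2 * w i * w j * Complex.I_sq

/-- On the Fourier side, multiplication by the off-diagonal part of the quadratic form amounts to
differentiating two of the factors. -/
lemma quadForm_mul_prod_fourier (f : 𝓢(ℝ, ℂ)) {S : Matrix ι ι ℝ} (hd : ∀ i, S i i = 1)
    (w : ι → ℝ) :
    (∏ k, 𝓕 f (w k)) * (-(2 * Real.pi ^ 2 * (w ⬝ᵥ (S - 1) *ᵥ w) : ℝ) : ℂ) =
      1 / 2 * ∑ i, ∑ j with j ≠ i, (S i j : ℂ) * ∏ k, 𝓕 (derivAt f i j k) (w k) := by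
  have h : w ⬝ᵥ (S - 1) *ᵥ w = ∑ i, ∑ j with j ≠ i, S i j * (w i * w j) := by
    simp only [dotProduct, Matrix.mulVec, Finset.mul_sum]
    refine Finset.sum_congr rfl fun i _ ↦ ?_
    rw [Finset.sum_filter]
    refine Finset.sum_congr rfl fun j _ ↦ ?_
    split_ifs with hj
    · simp [hj.symm]; ring
    · rw [not_not] at hj
      subst hj
      simp [hd]
  rw [h]
  push_cast
  simp only [Finset.mul_sum, mul_neg]
  rw [← Finset.sum_neg_distrib]
  refine Finset.sum_congr rfl fun i _ ↦ ?_
  rw [← Finset.sum_neg_distrib]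
  refine Finset.sum_congr rfl fun j hj ↦ ?_
  rw [prod_fourier_derivAt f (by simpa using (Finset.mem_filter.1 hj).2.symm)]
  ring

lemma norm_exp_interpMatrix_le {S : Matrix ι ι ℝ} (hS : S.PosSemidef) {t : ℝ} (h0 : 0 ≤ t)
    (h1 : t ≤ 1) (w : ι → ℝ) :
    ‖Complex.exp (-(2 * Real.pi ^ 2 * (w ⬝ᵥ interpMatrix S t *ᵥ w) : ℝ))‖ ≤ 1 := by
  rw [← Complex.ofReal_neg, Complex.norm_exp_ofReal, Real.exp_le_one_iff, neg_nonpos]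
  have := (interpMatrix_posSemidef hS h0 h1).dotProduct_mulVec_nonneg w
  simp only [star_trivial] at this
  positivity

lemma continuous_expInterp (S : Matrix ι ι ℝ) (t : ℝ) : Continuous fun w : ι → ℝ ↦
    Complex.exp (-(2 * Real.pi ^ 2 * (w ⬝ᵥ interpMatrix S t *ᵥ w) : ℝ)) := by
  simp only [dotProduct, Matrix.mulVec]
  fun_prop

/-- Moving the covariance matrix along the segment from `I` to `S`
differentiates the integrand in pairs of coordinates. -/
lemma hasDerivAt_integral_interpMatrix (f : 𝓢(ℝ, ℂ)) {S : Matrix ι ι ℝ} (hS : S.PosSemidef)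
    (hd : ∀ i, S i i = 1) {t : ℝ} (ht : t ∈ Set.Ioo (0 : ℝ) 1) :
    HasDerivAt (fun t ↦ ∫ x, ∏ k, f (x k) ∂(multivariateGaussian 0 (interpMatrix S t)))
      (1 / 2 * ∑ i, ∑ j with j ≠ i, (S i j : ℂ) *
        ∫ x, ∏ k, derivAt f i j k (x k) ∂(multivariateGaussian 0 (interpMatrix S t))) t := by
  set P : (ι → ℝ) → ℂ := fun w ↦ ∏ k, 𝓕 f (w k) with hP
  set q : (ι → ℝ) → ℝ := fun w ↦ w ⬝ᵥ (S - 1) *ᵥ w with hq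
  have hPc : Continuous P := continuous_prod_fourier fun _ ↦ f
  have hnhd : Set.Ioo (0 : ℝ) 1 ∈ 𝓝 t := Ioo_mem_nhds ht.1 ht.2
  have hPint : Integrable P := integrable_prod_fourier fun _ ↦ f
  have hbound : Integrable fun w ↦ P w * (-(2 * Real.pi ^ 2 * q w : ℝ) : ℂ) := by
    simp_rw [hP, hq, quadForm_mul_prod_fourier f hd]
    refine Integrable.const_mul ?_ _
    refine integrable_finsetSum _ fun i _ ↦ integrable_finsetSum _ fun j _ ↦ ?_
    exact (integrable_prod_fourier _).const_mul _
  have key := hasDerivAt_integral_of_dominated_loc_of_deriv_le (μ := (volume : Measure (ι → ℝ)))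
    (F := fun t w ↦ P w * Complex.exp (-(2 * Real.pi ^ 2 * (w ⬝ᵥ interpMatrix S t *ᵥ w) : ℝ)))
    (F' := fun t w ↦ P w * (-(2 * Real.pi ^ 2 * q w : ℝ) : ℂ) *
      Complex.exp (-(2 * Real.pi ^ 2 * (w ⬝ᵥ interpMatrix S t *ᵥ w) : ℝ)))
    (bound := fun w ↦ ‖P w * (-(2 * Real.pi ^ 2 * q w : ℝ) : ℂ)‖) hnhd
    (.of_forall fun s ↦ (hPc.mul (continuous_expInterp S s)).aestronglyMeasurable)
    (hPint.mono (hPc.mul (continuous_expInterp S t)).aestronglyMeasurable (.of_forall fun w ↦ by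
      rw [norm_mul]
      exact mul_le_of_le_one_right (norm_nonneg _)
        (norm_exp_interpMatrix_le hS ht.1.le ht.2.le w)))
    ((hbound.aestronglyMeasurable).mul (continuous_expInterp S t).aestronglyMeasurable)
    (.of_forall fun w s hs ↦ by
      rw [norm_mul]
      exact mul_le_of_le_one_right (norm_nonneg _)
        (norm_exp_interpMatrix_le hS hs.1.le hs.2.le w))
    hbound.norm
    (.of_forall fun w s _ ↦ by
      have h1 : HasDerivAt (fun s : ℝ ↦ ((-(2 * Real.pi ^ 2 * (w ⬝ᵥ w + s * q w)) : ℝ) : ℂ))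
          ((-(2 * Real.pi ^ 2 * q w) : ℝ) : ℂ) s := by
        refine HasDerivAt.ofReal_comp ?_
        have := (((hasDerivAt_id s).mul_const (q w)).const_add (w ⬝ᵥ w)).const_mul (2 * Real.pi ^ 2)
        simpa using! this.neg
      have h2 := (h1.cexp).const_mul (P w)
      simp_rw [dotProduct_interpMatrix, ← Complex.ofReal_neg]
      exact h2.congr_deriv (by ring))
  have h3 := key.2.congr_of_eventuallyEq (f₁ := fun t ↦ ∫ x, ∏ k, f (x k)
      ∂(multivariateGaussian 0 (interpMatrix S t))) (by
    filter_upwards [hnhd] with s hs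
    exact integral_prod_multivariateGaussian (interpMatrix_posSemidef hS hs.1.le hs.2.le) fun _ ↦ f)
  refine h3.congr_deriv (Eq.symm ?_)
  simp only [hP, hq, quadForm_mul_prod_fourier f hd, mul_assoc ((1 : ℂ) / 2), Finset.sum_mul]
  rw [integral_const_mul]
  congr 1
  have hint (i j : ι) : Integrable (fun w : ι → ℝ ↦ (S i j : ℂ) * (∏ k, 𝓕 (derivAt f i j k) (w k)) *
      Complex.exp (-(2 * Real.pi ^ 2 * (w ⬝ᵥ interpMatrix S t *ᵥ w) : ℝ))) := by
    refine ((integrable_prod_fourier (derivAt f i j)).const_mul (S i j : ℂ)).mono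
      (((continuous_prod_fourier _).const_smul (S i j : ℂ)).mul
        (continuous_expInterp S t)).aestronglyMeasurable (.of_forall fun w ↦ ?_)
    rw [norm_mul]
    exact mul_le_of_le_one_right (norm_nonneg _) (norm_exp_interpMatrix_le hS ht.1.le ht.2.le w)
  rw [integral_finsetSum _ fun i _ ↦ integrable_finsetSum _ fun j _ ↦ hint i j]
  refine Finset.sum_congr rfl fun i _ ↦ ?_
  rw [integral_finsetSum _ fun j _ ↦ hint i j]
  refine Finset.sum_congr rfl fun j _ ↦ ?_
  rw [integral_prod_multivariateGaussian (interpMatrix_posSemidef hS ht.1.le ht.2.le),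
    ← integral_const_mul]
  simp_rw [mul_assoc]

lemma continuousOn_integral_interpMatrix (f : 𝓢(ℝ, ℂ)) {S : Matrix ι ι ℝ} (hS : S.PosSemidef) :
    ContinuousOn (fun t ↦ ∫ x, ∏ k, f (x k) ∂(multivariateGaussian 0 (interpMatrix S t)))
      (Set.Icc 0 1) := by
  have h : ContinuousOn (fun t ↦ ∫ w : ι → ℝ, (∏ k, 𝓕 f (w k)) *
      Complex.exp (-(2 * Real.pi ^ 2 * (w ⬝ᵥ interpMatrix S t *ᵥ w) : ℝ))) (Set.Icc 0 1) := by
    refine continuousOn_of_dominated (F := fun t (w : ι → ℝ) ↦ (∏ k, 𝓕 f (w k)) *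
      Complex.exp (-(2 * Real.pi ^ 2 * (w ⬝ᵥ interpMatrix S t *ᵥ w) : ℝ)))
      (bound := fun w ↦ ‖∏ k, 𝓕 f (w k)‖)
      (fun t _ ↦ ((continuous_prod_fourier fun _ ↦ f).mul
        (continuous_expInterp S t)).aestronglyMeasurable)
      (fun t ht ↦ .of_forall fun w ↦ ?_) (integrable_prod_fourier fun _ ↦ f).norm
      (.of_forall fun w ↦ ?_)
    · rw [norm_mul]
      exact mul_le_of_le_one_right (norm_nonneg _) (norm_exp_interpMatrix_le hS ht.1 ht.2 w)
    · simp only [dotProduct_interpMatrix]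
      refine Continuous.continuousOn (continuous_const.mul ?_)
      fun_prop
  refine h.congr fun t ht ↦ ?_
  exact integral_prod_multivariateGaussian (interpMatrix_posSemidef hS ht.1 ht.2) fun _ ↦ f

/-- Gaussian interpolation: the change of `E ∏ g(X_k)` from independent coordinates to the
correlation matrix `S` is given by the off-diagonal entries of `S`, weighted by expectations under
an intermediate covariance matrix. -/
theorem exists_integral_prod_sub_eq {g : ℝ → ℝ} (hg : ContDiff ℝ ∞ g) (hc : HasCompactSupport g)
    {S : Matrix ι ι ℝ} (hS : S.PosSemidef) (hd : ∀ i, S i i = 1) :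
    ∃ t ∈ Set.Ioo (0 : ℝ) 1,
      ∫ x, ∏ k, g (x k) ∂(multivariateGaussian 0 S) -
        ∫ x, ∏ k, g (x k) ∂(multivariateGaussian 0 (1 : Matrix ι ι ℝ)) =
      1 / 2 * ∑ i, ∑ j with j ≠ i, S i j *
        ∫ x, deriv g (x i) * deriv g (x j) * ∏ k ∈ ({i, j} : Finset ι)ᶜ, g (x k)
          ∂(multivariateGaussian 0 (interpMatrix S t)) := by
  have hcf : HasCompactSupport fun x ↦ (g x : ℂ) := hc.comp_left (g := Complex.ofReal) (by simp)
  set f : 𝓢(ℝ, ℂ) := hcf.toSchwartzMap ((Complex.ofRealCLM.contDiff (n := ∞)).comp hg)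
  have hfx (x : ℝ) : f x = g x := rfl
  have hf' (x : ℝ) : SchwartzMap.derivCLM ℂ ℂ f x = (deriv g x : ℝ) := by
    rw [SchwartzMap.derivCLM_apply]
    exact ((hg.differentiable (by simp)) x).hasDerivAt.ofReal_comp.deriv
  have h1 (A : Matrix ι ι ℝ) : ∫ x, ∏ k, f (x k) ∂(multivariateGaussian 0 A) =
      ((∫ x, ∏ k, g (x k) ∂(multivariateGaussian 0 A) : ℝ) : ℂ) := by
    rw [← integral_complex_ofReal]
    simp [hfx]
  have h2 (A : Matrix ι ι ℝ) {i j : ι} (hij : i ≠ j) :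
      ∫ x, ∏ k, derivAt f i j k (x k) ∂(multivariateGaussian 0 A) =
      ((∫ x, deriv g (x i) * deriv g (x j) * ∏ k ∈ ({i, j} : Finset ι)ᶜ, g (x k)
          ∂(multivariateGaussian 0 A) : ℝ) : ℂ) := by
    rw [← integral_complex_ofReal]
    refine integral_congr_ae (.of_forall fun x ↦ ?_)
    have (k : ι) : derivAt f i j k (x k) =
        if k = i ∨ k = j then ((deriv g (x k) : ℝ) : ℂ) else (g (x k) : ℂ) := by
      unfold derivAt
      split_ifs
      · exact hf' _
      · rfl
    simp only [this]
    rw [Finset.prod_ite_pair hij (fun k ↦ ((deriv g (x k) : ℝ) : ℂ)) (fun k ↦ (g (x k) : ℂ))]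
    push_cast
    rfl
  obtain ⟨t, ht, h⟩ := exists_hasDerivAt_eq_slope
    (fun t ↦ ∫ x, ∏ k, g (x k) ∂(multivariateGaussian 0 (interpMatrix S t)))
    (fun t ↦ 1 / 2 * ∑ i, ∑ j with j ≠ i, S i j *
        ∫ x, deriv g (x i) * deriv g (x j) * ∏ k ∈ ({i, j} : Finset ι)ᶜ, g (x k)
          ∂(multivariateGaussian 0 (interpMatrix S t))) zero_lt_one
    (by
      have := Complex.continuous_re.comp_continuousOn (continuousOn_integral_interpMatrix f hS)
      refine this.congr fun t _ ↦ ?_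
      simp [h1])
    (fun t ht ↦ by
      have := (hasDerivAt_integral_interpMatrix f hS hd ht)
      have h3 : (1 / 2 * ∑ i, ∑ j with j ≠ i, (S i j : ℂ) *
        ∫ x, ∏ k, derivAt f i j k (x k) ∂(multivariateGaussian 0 (interpMatrix S t))) =
          ((1 / 2 * ∑ i, ∑ j with j ≠ i, S i j *
        ∫ x, deriv g (x i) * deriv g (x j) * ∏ k ∈ ({i, j} : Finset ι)ᶜ, g (x k)
          ∂(multivariateGaussian 0 (interpMatrix S t)) : ℝ) : ℂ) := by
        push_cast
        congr 1
        refine Finset.sum_congr rfl fun i _ ↦ Finset.sum_congr rfl fun j hj ↦ ?_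
        rw [h2 _ (by simpa using (Finset.mem_filter.1 hj).2.symm)]
      simp only [h1] at this
      rw [h3] at this
      simpa using! Complex.reCLM.hasFDerivAt.comp_hasDerivAt t this)
  refine ⟨t, ht, ?_⟩
  rw [h]
  simp

end Fourier

/-! ### Smooth cutoffs and the comparison of orthant probabilities -/

section Cutoff

/-- A smooth nonincreasing approximation of the indicator of `(-∞, c]`: it is `1` on `(-∞, c]` and
`0` on `[c + δ, ∞)`. -/
noncomputable def cutoff (c δ x : ℝ) : ℝ := 1 - Real.smoothTransition ((x - c) / δ)

lemma contDiff_cutoff (c δ : ℝ) : ContDiff ℝ ∞ (cutoff c δ) := by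
  unfold cutoff
  exact contDiff_const.sub (Real.smoothTransition.contDiff.comp
    ((contDiff_id.sub contDiff_const).div_const _))

lemma continuous_cutoff (c δ : ℝ) : Continuous (cutoff c δ) := (contDiff_cutoff c δ).continuous

lemma differentiable_cutoff (c δ : ℝ) : Differentiable ℝ (cutoff c δ) :=
  (contDiff_cutoff c δ).differentiable (by simp)

lemma continuous_deriv_cutoff (c δ : ℝ) : Continuous (deriv (cutoff c δ)) :=
  (contDiff_cutoff c δ).continuous_deriv (by simp)

lemma cutoff_nonneg (c δ x : ℝ) : 0 ≤ cutoff c δ x :=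
  sub_nonneg.2 (Real.smoothTransition.le_one _)

lemma cutoff_le_one (c δ x : ℝ) : cutoff c δ x ≤ 1 :=
  sub_le_self _ (Real.smoothTransition.nonneg _)

lemma cutoff_eq_one {c δ x : ℝ} (hδ : 0 < δ) (hx : x ≤ c) : cutoff c δ x = 1 := by
  rw [cutoff, Real.smoothTransition.zero_of_nonpos, sub_zero]
  exact div_nonpos_of_nonpos_of_nonneg (by linarith) hδ.le

lemma cutoff_eq_zero {c δ x : ℝ} (hδ : 0 < δ) (hx : c + δ ≤ x) : cutoff c δ x = 0 := by
  rw [cutoff, Real.smoothTransition.one_of_one_le, sub_self]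
  rw [le_div_iff₀ hδ]
  linarith

lemma deriv_cutoff_nonpos {c δ : ℝ} (hδ : 0 < δ) (x : ℝ) : deriv (cutoff c δ) x ≤ 0 := by
  refine Antitone.deriv_nonpos fun a b hab ↦ ?_
  unfold cutoff
  exact sub_le_sub_left (Real.smoothTransition.monotone (by gcongr)) _

lemma deriv_cutoff_eq_zero {c δ x : ℝ} (hδ : 0 < δ) (hx : x ∉ Set.Icc c (c + δ)) :
    deriv (cutoff c δ) x = 0 := by
  rw [Set.mem_Icc, not_and_or, not_le, not_le] at hx
  rcases hx with hx | hx
  · have : cutoff c δ =ᶠ[𝓝 x] fun _ ↦ 1 := by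
      filter_upwards [gt_mem_nhds hx] with y hy using cutoff_eq_one hδ hy.le
    rw [this.deriv_eq, deriv_const]
  · have : cutoff c δ =ᶠ[𝓝 x] fun _ ↦ 0 := by
      filter_upwards [lt_mem_nhds hx] with y hy using cutoff_eq_zero hδ hy.le
    rw [this.deriv_eq, deriv_const]

lemma hasCompactSupport_deriv_cutoff {c δ : ℝ} (hδ : 0 < δ) :
    HasCompactSupport (deriv (cutoff c δ)) :=
  HasCompactSupport.intro isCompact_Icc fun _ hx ↦ deriv_cutoff_eq_zero hδ hx

lemma exists_abs_deriv_cutoff_le {c δ : ℝ} (hδ : 0 < δ) :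
    ∃ M, ∀ x, |deriv (cutoff c δ) x| ≤ M :=
  (continuous_deriv_cutoff c δ).bounded_above_of_compact_support
    (hasCompactSupport_deriv_cutoff hδ)

lemma integral_deriv_cutoff {c δ : ℝ} (hδ : 0 < δ) : ∫ x, deriv (cutoff c δ) x = -1 := by
  have h1 : ∫ x in c..(c + δ), deriv (cutoff c δ) x = -1 := by
    rw [intervalIntegral.integral_deriv_eq_sub (fun x _ ↦ differentiable_cutoff c δ x)
      ((continuous_deriv_cutoff c δ).intervalIntegrable _ _), cutoff_eq_zero hδ le_rfl,
      cutoff_eq_one hδ le_rfl]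
    norm_num
  rw [← h1, intervalIntegral.integral_of_le (by linarith), ← integral_Icc_eq_integral_Ioc,
    setIntegral_eq_integral_of_forall_compl_eq_zero fun x hx ↦ deriv_cutoff_eq_zero hδ hx]

/-- The truncation of `cutoff` to a compactly supported function: it vanishes on `(-∞, -L]` and
agrees with `cutoff` on `[1 - L, ∞)`. Compact support makes Gaussian
interpolation applicable. -/
noncomputable def truncCutoff (c δ L x : ℝ) : ℝ := cutoff c δ x * Real.smoothTransition (x + L)

lemma contDiff_truncCutoff (c δ L : ℝ) : ContDiff ℝ ∞ (truncCutoff c δ L) :=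
  (contDiff_cutoff c δ).mul (Real.smoothTransition.contDiff.comp (contDiff_id.add contDiff_const))

lemma hasCompactSupport_truncCutoff {c δ L : ℝ} (hδ : 0 < δ) :
    HasCompactSupport (truncCutoff c δ L) := by
  refine HasCompactSupport.intro (isCompact_Icc (a := -L) (b := c + δ)) fun x hx ↦ ?_
  rw [Set.mem_Icc, not_and_or, not_le, not_le] at hx
  rcases hx with hx | hx
  · rw [truncCutoff, Real.smoothTransition.zero_of_nonpos (by linarith), mul_zero]
  · rw [truncCutoff, cutoff_eq_zero hδ hx.le, zero_mul]

lemma truncCutoff_nonneg (c δ L x : ℝ) : 0 ≤ truncCutoff c δ L x :=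
  mul_nonneg (cutoff_nonneg _ _ _) (Real.smoothTransition.nonneg _)

lemma truncCutoff_le_one (c δ L x : ℝ) : truncCutoff c δ L x ≤ 1 :=
  mul_le_one₀ (cutoff_le_one _ _ _) (Real.smoothTransition.nonneg _)
    (Real.smoothTransition.le_one _)

lemma truncCutoff_eq {c δ L x : ℝ} (hx : 1 - L ≤ x) : truncCutoff c δ L x = cutoff c δ x := by
  rw [truncCutoff, Real.smoothTransition.one_of_one_le (by linarith), mul_one]

lemma deriv_truncCutoff_eq {c δ L x : ℝ} (hx : 1 - L < x) :
    deriv (truncCutoff c δ L) x = deriv (cutoff c δ) x := by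
  have : truncCutoff c δ L =ᶠ[𝓝 x] cutoff c δ := by
    filter_upwards [lt_mem_nhds hx] with y hy using truncCutoff_eq hy.le
  exact this.deriv_eq

lemma exists_abs_deriv_truncCutoff_le {c δ : ℝ} (hδ : 0 < δ) :
    ∃ M, ∀ L x, |deriv (truncCutoff c δ L) x| ≤ M := by
  obtain ⟨M, hM⟩ := exists_abs_deriv_cutoff_le (c := c) hδ
  obtain ⟨M', hM'⟩ := exists_abs_deriv_cutoff_le (c := 0) (δ := 1) one_pos
  refine ⟨M + M', fun L x ↦ ?_⟩
  -- the truncating factor is itself a reflected cutoff, so the same bound serves for both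
  have hT : Real.smoothTransition = fun x ↦ 1 - cutoff 0 1 x := by
    ext x; simp [cutoff]
  have h1 : HasDerivAt (fun x ↦ Real.smoothTransition (x + L)) (-deriv (cutoff 0 1) (x + L)) x := by
    rw [hT]
    exact (((differentiable_cutoff 0 1 (x + L)).hasDerivAt).comp_add_const x L).const_sub 1
  have h2 := ((differentiable_cutoff c δ x).hasDerivAt.mul h1).deriv
  have h3 : deriv (truncCutoff c δ L) x = deriv (cutoff c δ) x * Real.smoothTransition (x + L) +
      cutoff c δ x * -deriv (cutoff 0 1) (x + L) := h2
  rw [h3]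
  refine (abs_add_le _ _).trans (add_le_add ?_ ?_)
  · rw [abs_mul, abs_of_nonneg (Real.smoothTransition.nonneg _)]
    exact (mul_le_of_le_one_right (abs_nonneg _) (Real.smoothTransition.le_one _)).trans (hM x)
  · rw [abs_mul, abs_of_nonneg (cutoff_nonneg _ _ _), abs_neg]
    exact (mul_le_of_le_one_left (abs_nonneg _) (cutoff_le_one _ _ _)).trans (hM' _)

end Cutoff

section Limit

lemma abs_mul_mul_prod_le {ι : Type*} {M a b : ℝ} (ha : |a| ≤ M) (hb : |b| ≤ M)
    (s : Finset ι) {g : ι → ℝ}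
    (h0 : ∀ k, 0 ≤ g k) (h1 : ∀ k, g k ≤ 1) : |a * b * ∏ k ∈ s, g k| ≤ M ^ 2 := by
  have hp0 : 0 ≤ ∏ k ∈ s, g k := Finset.prod_nonneg fun k _ ↦ h0 k
  have hp1 : ∏ k ∈ s, g k ≤ 1 := Finset.prod_le_one (fun k _ ↦ h0 k) fun k _ ↦ h1 k
  rw [abs_mul, abs_mul, abs_of_nonneg hp0, sq]
  have hM : 0 ≤ M := (abs_nonneg a).trans ha
  calc |a| * |b| * ∏ k ∈ s, g k ≤ M * M * 1 := by gcongr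
    _ = M * M := mul_one _

variable {ι : Type*} [Fintype ι] [DecidableEq ι]

lemma measurePreserving_eval_of_diag {S : Matrix ι ι ℝ} (hS : S.PosSemidef) {i : ι}
    (hd : S i i = 1) :
    MeasurePreserving (fun x : EuclideanSpace ℝ ι ↦ x i) (multivariateGaussian 0 S)
      (gaussianReal 0 1) := by
  have := measurePreserving_eval_multivariateGaussian (μ := 0) hS (i := i)
  simpa [hd] using this

lemma measureReal_exists_le_le {S : Matrix ι ι ℝ} (hS : S.PosSemidef) (hd : ∀ i, S i i = 1)
    (a : ℝ) :
    (multivariateGaussian 0 S).real {x : EuclideanSpace ℝ ι | ∃ i, x i ≤ a} ≤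
      Fintype.card ι * (gaussianReal 0 1).real (Set.Iic a) := by
  have h : {x : EuclideanSpace ℝ ι | ∃ i, x i ≤ a} = ⋃ i, (fun x ↦ x i) ⁻¹' Set.Iic a := by
    ext; simp
  rw [h]
  refine (measureReal_iUnion_fintype_le _).trans ?_
  have (i : ι) : (multivariateGaussian 0 S).real
      ((fun x : EuclideanSpace ℝ ι ↦ x i) ⁻¹' Set.Iic a) = (gaussianReal 0 1).real (Set.Iic a) :=
    (measurePreserving_eval_of_diag hS (hd i)).measureReal_preimage
      measurableSet_Iic.nullMeasurableSet
  simp [this]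

/-- For a centered Gaussian vector `X` with covariance matrix `S`, the integral
`E[G'(X_i) G'(X_j) ∏_{k ≠ i, j} G(X_k)]` with `G` the smooth cutoff at `c`. As `δ → 0` it
approximates the density of `(X_i, X_j)` at `(c, c)` times the conditional probability that the
other coordinates are at most `c`. -/
noncomputable def pairIntegral (S : Matrix ι ι ℝ) (c δ : ℝ) (i j : ι) : ℝ :=
  ∫ x, deriv (cutoff c δ) (x i) * deriv (cutoff c δ) (x j) *
    ∏ k ∈ ({i, j} : Finset ι)ᶜ, cutoff c δ (x k) ∂(multivariateGaussian 0 S)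

/-- The probability that all coordinates of a centered Gaussian vector are at most `c`. -/
noncomputable def orthantProb (S : Matrix ι ι ℝ) (c : ℝ) : ℝ :=
  (multivariateGaussian 0 S).real {x : EuclideanSpace ℝ ι | ∀ i, x i ≤ c}

lemma continuous_pairIntegrand {g g' : ℝ → ℝ} (hg : Continuous g) (hg' : Continuous g')
    (i j : ι) : Continuous fun x : EuclideanSpace ℝ ι ↦
      g' (x i) * g' (x j) * ∏ k ∈ ({i, j} : Finset ι)ᶜ, g (x k) := by
  fun_prop

/-- The truncation changes the integrand only where some coordinate is at most `1 - L`, an event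
whose probability is bounded independently of the correlations. -/
lemma abs_integral_trunc_sub_pairIntegral_le {S : Matrix ι ι ℝ} (hS : S.PosSemidef)
    (hd : ∀ i, S i i = 1) {c δ M : ℝ} (hM : ∀ L x, |deriv (truncCutoff c δ L) x| ≤ M)
    (hM' : ∀ x, |deriv (cutoff c δ) x| ≤ M) (L : ℝ) (i j : ι) :
    |∫ x, deriv (truncCutoff c δ L) (x i) * deriv (truncCutoff c δ L) (x j) *
      ∏ k ∈ ({i, j} : Finset ι)ᶜ, truncCutoff c δ L (x k) ∂(multivariateGaussian 0 S) -
      pairIntegral S c δ i j| ≤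
    2 * M ^ 2 * (Fintype.card ι * (gaussianReal 0 1).real (Set.Iic (1 - L))) := by
  set μ := multivariateGaussian 0 S
  set A : Set (EuclideanSpace ℝ ι) := {x | ∃ i, x i ≤ 1 - L} with hA
  have hAm : MeasurableSet A := by
    have : A = ⋃ i, (fun x ↦ x i) ⁻¹' Set.Iic (1 - L) := by ext; simp [hA]
    rw [this]
    exact .iUnion fun i ↦
      (by fun_prop : Measurable fun x : EuclideanSpace ℝ ι ↦ x i) measurableSet_Iic
  have b1 (x : EuclideanSpace ℝ ι) := abs_mul_mul_prod_le (hM L (x i)) (hM L (x j))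
    ({i, j} : Finset ι)ᶜ (fun k ↦ truncCutoff_nonneg c δ L (x k))
    (fun k ↦ truncCutoff_le_one c δ L (x k))
  have b2 (x : EuclideanSpace ℝ ι) := abs_mul_mul_prod_le (hM' (x i)) (hM' (x j))
    ({i, j} : Finset ι)ᶜ (fun k ↦ cutoff_nonneg c δ (x k)) (fun k ↦ cutoff_le_one c δ (x k))
  have c1 := continuous_pairIntegrand (ι := ι) (contDiff_truncCutoff c δ L).continuous
    ((contDiff_truncCutoff c δ L).continuous_deriv (by simp)) i j
  have c2 := continuous_pairIntegrand (ι := ι) (continuous_cutoff c δ)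
    (continuous_deriv_cutoff c δ) i j
  rw [pairIntegral, ← integral_sub
    (.of_bound c1.aestronglyMeasurable (M ^ 2) (.of_forall b1))
    (.of_bound c2.aestronglyMeasurable (M ^ 2) (.of_forall b2))]
  refine le_trans ?_ (mul_le_mul_of_nonneg_left (measureReal_exists_le_le hS hd (1 - L))
    (by positivity))
  have h1 : ∫ x, A.indicator (fun _ ↦ 2 * M ^ 2) x ∂μ = 2 * M ^ 2 * μ.real A := by
    rw [integral_indicator_const _ hAm, smul_eq_mul, mul_comm]
  rw [← h1, ← Real.norm_eq_abs]
  refine norm_integral_le_of_norm_le ((integrable_const _).indicator hAm) (.of_forall fun x ↦ ?_)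
  by_cases hx : x ∈ A
  · rw [Set.indicator_of_mem hx, Real.norm_eq_abs]
    refine (abs_sub _ _).trans ?_
    linarith [b1 x, b2 x]
  · rw [Set.indicator_of_notMem hx]
    have hx' : ∀ k, 1 - L < x k := by simpa [hA] using hx
    simp only [deriv_truncCutoff_eq (hx' _), truncCutoff_eq (hx' _).le, sub_self, norm_zero,
      le_refl]

/-- The comparison for smooth cutoffs, where the truncation has been removed by `L → ∞`. -/
lemma abs_integral_cutoff_sub_le {S : Matrix ι ι ℝ} (hS : S.PosSemidef) (hd : ∀ i, S i i = 1)
    {c δ κ e : ℝ} (hδ : 0 < δ)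
    (h : ∀ t ∈ Set.Ioo (0 : ℝ) 1, ∀ i j, i ≠ j →
      |pairIntegral (interpMatrix S t) c δ i j - κ| ≤ e) :
    |∫ x, ∏ k, cutoff c δ (x k) ∂(multivariateGaussian 0 S) -
        ∫ x, ∏ k, cutoff c δ (x k) ∂(multivariateGaussian 0 (1 : Matrix ι ι ℝ)) -
        κ / 2 * ∑ i, ∑ j with j ≠ i, S i j| ≤ e / 2 * ∑ i, ∑ j with j ≠ i, |S i j| := by
  obtain ⟨M₁, hM₁⟩ := exists_abs_deriv_cutoff_le (c := c) hδ
  obtain ⟨M₂, hM₂⟩ := exists_abs_deriv_truncCutoff_le (c := c) hδ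
  set M := max M₁ M₂
  set err : ℝ → ℝ := fun L ↦
    2 * M ^ 2 * (Fintype.card ι * (gaussianReal 0 1).real (Set.Iic (1 - L))) with herr
  have herr0 : Tendsto err atTop (𝓝 0) := by
    have h1 : Tendsto (fun L : ℝ ↦ (gaussianReal 0 1).real (Set.Iic (1 - L))) atTop (𝓝 0) := by
      have := (tendsto_cdf_atBot (gaussianReal 0 1)).comp
        (tendsto_atBot_add_const_left atTop (1 : ℝ) tendsto_neg_atTop_atBot)
      simpa [Function.comp_def, cdf_eq_real, ← sub_eq_add_neg] using this
    simpa using (h1.const_mul (Fintype.card ι : ℝ)).const_mul (2 * M ^ 2)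
  have hlim (A : Matrix ι ι ℝ) : Tendsto
      (fun L ↦ ∫ x, ∏ k, truncCutoff c δ L (x k) ∂(multivariateGaussian 0 A)) atTop
      (𝓝 (∫ x, ∏ k, cutoff c δ (x k) ∂(multivariateGaussian 0 A))) := by
    refine tendsto_integral_filter_of_dominated_convergence (fun _ ↦ 1)
      (.of_forall fun L ↦ ?_) (.of_forall fun L ↦ .of_forall fun x ↦ ?_) (integrable_const _)
      (.of_forall fun x ↦ ?_)
    · have := (contDiff_truncCutoff c δ L).continuous
      exact Continuous.aestronglyMeasurable (by fun_prop)
    · rw [Real.norm_eq_abs, abs_of_nonneg (Finset.prod_nonneg fun k _ ↦ truncCutoff_nonneg _ _ _ _)]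
      exact Finset.prod_le_one (fun k _ ↦ truncCutoff_nonneg _ _ _ _)
        fun k _ ↦ truncCutoff_le_one _ _ _ _
    · refine tendsto_finsetProd _ fun k _ ↦ ?_
      refine tendsto_const_nhds.congr' ?_
      filter_upwards [eventually_ge_atTop (1 - x k)] with L hL
      rw [truncCutoff_eq (by linarith)]
  have hineq (L : ℝ) : |∫ x, ∏ k, truncCutoff c δ L (x k) ∂(multivariateGaussian 0 S) -
        ∫ x, ∏ k, truncCutoff c δ L (x k) ∂(multivariateGaussian 0 (1 : Matrix ι ι ℝ)) -
        κ / 2 * ∑ i, ∑ j with j ≠ i, S i j| ≤ (e + err L) / 2 * ∑ i, ∑ j with j ≠ i, |S i j| := by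
    obtain ⟨t, ht, heq⟩ := exists_integral_prod_sub_eq (contDiff_truncCutoff c δ L)
      (hasCompactSupport_truncCutoff hδ) hS hd
    rw [heq]
    have hrw (a : ℝ) (F : ι → ι → ℝ) : a / 2 * ∑ i, ∑ j with j ≠ i, F i j =
        1 / 2 * ∑ i, ∑ j with j ≠ i, a * F i j := by
      simp only [Finset.mul_sum]
      refine Finset.sum_congr rfl fun i _ ↦ Finset.sum_congr rfl fun j _ ↦ ?_
      ring
    rw [hrw κ fun i j ↦ S i j, hrw (e + err L) fun i j ↦ |S i j|, ← mul_sub, abs_mul,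
      abs_of_pos (by norm_num : (0 : ℝ) < 1 / 2), ← Finset.sum_sub_distrib]
    refine mul_le_mul_of_nonneg_left ?_ (by norm_num)
    refine (Finset.abs_sum_le_sum_abs _ _).trans (Finset.sum_le_sum fun i _ ↦ ?_)
    rw [← Finset.sum_sub_distrib]
    refine (Finset.abs_sum_le_sum_abs _ _).trans (Finset.sum_le_sum fun j hj ↦ ?_)
    have hij : i ≠ j := by simpa using (Finset.mem_filter.1 hj).2.symm
    rw [mul_comm κ, ← mul_sub, abs_mul, mul_comm]
    refine mul_le_mul_of_nonneg_right ?_ (abs_nonneg _)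
    have e1 := abs_integral_trunc_sub_pairIntegral_le
      (interpMatrix_posSemidef hS ht.1.le ht.2.le) (fun i ↦ interpMatrix_apply_self t (hd i))
      (fun L x ↦ (hM₂ L x).trans (le_max_right M₁ M₂))
      (fun x ↦ (hM₁ x).trans (le_max_left M₁ M₂)) L i j
    have e2 := h t ht i j hij
    have e3 := abs_sub_le (∫ x, deriv (truncCutoff c δ L) (x i) * deriv (truncCutoff c δ L) (x j) *
      ∏ k ∈ ({i, j} : Finset ι)ᶜ, truncCutoff c δ L (x k)
        ∂(multivariateGaussian 0 (interpMatrix S t)))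
      (pairIntegral (interpMatrix S t) c δ i j) κ
    linarith
  refine le_of_tendsto_of_tendsto (((hlim S).sub (hlim 1)).sub_const _).abs ?_
    (.of_forall hineq)
  simpa using ((herr0.const_add e).div_const 2).mul_const (∑ i, ∑ j with j ≠ i, |S i j|)

lemma tendsto_integral_cutoff (A : Matrix ι ι ℝ) (c : ℝ) : Tendsto
    (fun δ ↦ ∫ x, ∏ k, cutoff c δ (x k) ∂(multivariateGaussian 0 A)) (𝓝[>] 0)
    (𝓝 (orthantProb A c)) := by
  have hm : MeasurableSet {x : EuclideanSpace ℝ ι | ∀ i, x i ≤ c} := by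
    rw [Set.ofPred_forall]
    exact .iInter fun i ↦
      (by fun_prop : Measurable fun x : EuclideanSpace ℝ ι ↦ x i) measurableSet_Iic
  have h : orthantProb A c = ∫ x, {x : EuclideanSpace ℝ ι | ∀ i, x i ≤ c}.indicator
      (fun _ ↦ (1 : ℝ)) x ∂(multivariateGaussian 0 A) := by
    rw [integral_indicator_const _ hm, smul_eq_mul, mul_one, orthantProb]
  rw [h]
  refine tendsto_integral_filter_of_dominated_convergence (fun _ ↦ 1)
    (.of_forall fun δ ↦ ?_) (.of_forall fun δ ↦ .of_forall fun x ↦ ?_) (integrable_const _)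
    (.of_forall fun x ↦ ?_)
  · have := continuous_cutoff c δ
    exact Continuous.aestronglyMeasurable (by fun_prop)
  · rw [Real.norm_eq_abs, abs_of_nonneg (Finset.prod_nonneg fun k _ ↦ cutoff_nonneg _ _ _)]
    exact Finset.prod_le_one (fun k _ ↦ cutoff_nonneg _ _ _) fun k _ ↦ cutoff_le_one _ _ _
  · refine tendsto_const_nhds.congr' ?_
    by_cases hx : ∀ i, x i ≤ c
    · filter_upwards [self_mem_nhdsWithin] with δ hδ
      rw [Set.indicator_of_mem (by exact hx)]
      exact (Finset.prod_eq_one fun k _ ↦ cutoff_eq_one hδ (hx k)).symm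
    · rw [Set.indicator_of_notMem (by exact hx)]
      push Not at hx
      obtain ⟨k, hk⟩ := hx
      filter_upwards [Ioo_mem_nhdsGT (sub_pos.2 hk)] with δ hδ
      exact (Finset.prod_eq_zero (Finset.mem_univ k)
        (cutoff_eq_zero hδ.1 (by linarith [hδ.2]))).symm

/-- The normal comparison principle in quantitative form: if all the pair integrals along the
segment from `I` to `S` are within `e` of `κ`, then so is, relative to `∑ |S_ij| / 2`, the change
of the orthant probability. -/
theorem abs_orthantProb_sub_le {S : Matrix ι ι ℝ} (hS : S.PosSemidef) (hd : ∀ i, S i i = 1)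
    {c κ e : ℝ}
    (h : ∀ᶠ δ in 𝓝[>] 0, ∀ t ∈ Set.Ioo (0 : ℝ) 1, ∀ i j, i ≠ j →
      |pairIntegral (interpMatrix S t) c δ i j - κ| ≤ e) :
    |orthantProb S c - orthantProb (1 : Matrix ι ι ℝ) c - κ / 2 * ∑ i, ∑ j with j ≠ i, S i j| ≤
      e / 2 * ∑ i, ∑ j with j ≠ i, |S i j| := by
  refine le_of_tendsto (((tendsto_integral_cutoff S c).sub
    (tendsto_integral_cutoff 1 c)).sub_const _).abs ?_
  filter_upwards [h, self_mem_nhdsWithin] with δ h1 hδ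
  exact abs_integral_cutoff_sub_le hS hd hδ h1

end Limit

/-! ### The joint density of two weakly correlated coordinates -/

section Density

open scoped NNReal

/-- The standard normal density. -/
noncomputable def stdPDF (x : ℝ) : ℝ := gaussianPDFReal 0 1 x

lemma stdPDF_eq (x : ℝ) : stdPDF x = (√(2 * Real.pi))⁻¹ * Real.exp (-x ^ 2 / 2) := by
  simp [stdPDF, gaussianPDFReal]

lemma stdPDF_pos (x : ℝ) : 0 < stdPDF x := gaussianPDFReal_pos _ _ _ one_ne_zero

lemma stdPDF_le {c x : ℝ} (hc : 0 ≤ c) (hx : c ≤ x) : stdPDF x ≤ stdPDF c := by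
  rw [stdPDF_eq, stdPDF_eq]
  gcongr

lemma le_stdPDF {c δ h x : ℝ} (hδc : δ ≤ c) (hδ : c * δ ≤ h)
    (hx : x ∈ Set.Icc c (c + δ)) : Real.exp (-(2 * h)) * stdPDF c ≤ stdPDF x := by
  have h1 : 0 ≤ δ := by linarith [hx.1, hx.2]
  rw [stdPDF_eq, stdPDF_eq, mul_left_comm, ← Real.exp_add]
  gcongr
  nlinarith [hx.1, hx.2, mul_le_mul_of_nonneg_right hδc h1]

/-- The conditional density of `X_j` given `X_i = x` is close to `φ(c)` near `c`, uniformly over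
correlations `r` with `|r| c²` small. -/
lemma gaussianPDFReal_le_and_le {c δ h u r x y : ℝ} {v : ℝ≥0} (hc : 1 ≤ c)
    (hδc : δ ≤ c) (hδ : c * δ ≤ h) (hr : |r| ≤ u) (hu : u * c ^ 2 ≤ h) (hh : h ≤ 1 / 4)
    (hv : (v : ℝ) = 1 - r ^ 2) (hx : x ∈ Set.Icc c (c + δ)) (hy : y ∈ Set.Icc c (c + δ)) :
    Real.exp (-(6 * h)) * stdPDF c ≤ gaussianPDFReal (r * x) v y ∧
      gaussianPDFReal (r * x) v y ≤ Real.exp (7 * h) * stdPDF c := by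
  have hδ0 : 0 ≤ δ := by linarith [hx.1, hx.2]
  have hu0 : 0 ≤ u := (abs_nonneg r).trans hr
  have hcc : 1 ≤ c ^ 2 := one_le_pow₀ hc
  have huh : u ≤ h := (le_mul_of_one_le_right hu0 hcc).trans hu
  have h0 : 0 ≤ h := hu0.trans huh
  have hr2 : r ^ 2 ≤ u ^ 2 := sq_le_sq' (neg_le_of_abs_le hr) (le_of_abs_le hr)
  have hr2h : r ^ 2 ≤ h ^ 2 := hr2.trans (pow_le_pow_left₀ hu0 huh 2)
  have hv1 : (v : ℝ) ≤ 1 := by rw [hv]; linarith [sq_nonneg r]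
  have hv2 : 15 / 16 ≤ (v : ℝ) := by rw [hv]; nlinarith
  have hv0 : 0 < (v : ℝ) := by linarith
  -- the distance of `y - r x` from `c`, multiplied by `c`, is of order `h`
  set z := y - r * x with hz
  have hzc : |z - c| ≤ δ + 2 * (u * c) := by
    have e1 : z - c = (y - c) - r * x := by rw [hz]; ring
    rw [e1]
    refine (abs_sub _ _).trans (add_le_add ?_ ?_)
    · rw [abs_of_nonneg (by linarith [hy.1])]; linarith [hy.2]
    · rw [abs_mul, abs_of_nonneg (by linarith [hx.1] : 0 ≤ x)]
      have : x ≤ 2 * c := by linarith [hx.2]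
      calc |r| * x ≤ u * (2 * c) := by
            exact mul_le_mul hr this (by linarith [hx.1]) hu0
        _ = 2 * (u * c) := by ring
  have hczc : c * |z - c| ≤ 3 * h := by
    calc c * |z - c| ≤ c * (δ + 2 * (u * c)) := by gcongr
      _ = c * δ + 2 * (u * c ^ 2) := by ring
      _ ≤ 3 * h := by linarith
  have hzc3 : |z - c| ≤ 3 * h := (le_mul_of_one_le_left (abs_nonneg _) hc).trans hczc
  have hz2 : |z ^ 2 - c ^ 2| ≤ 9 * h := by
    have e1 : z ^ 2 - c ^ 2 = 2 * (c * (z - c)) + (z - c) ^ 2 := by ring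
    rw [e1]
    refine (abs_add_le _ _).trans ?_
    rw [abs_mul, abs_mul, abs_of_nonneg (by linarith : 0 ≤ c), abs_of_pos (by norm_num : (0:ℝ) < 2),
      abs_of_nonneg (sq_nonneg (z - c)), ← sq_abs (z - c), sq]
    have e2 : |z - c| * |z - c| ≤ (3 * h) * (3 * h) :=
      mul_le_mul hzc3 hzc3 (abs_nonneg _) (by linarith)
    have e3 : h * h ≤ 1 / 4 * h := mul_le_mul_of_nonneg_right hh h0
    linarith
  have hrc : r ^ 2 * c ^ 2 ≤ h := by
    calc r ^ 2 * c ^ 2 ≤ u ^ 2 * c ^ 2 := by gcongr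
      _ = u * (u * c ^ 2) := by ring
      _ ≤ 1 * h := mul_le_mul (by linarith) hu (by positivity) zero_le_one
      _ = h := one_mul h
  have hexp : |z ^ 2 / (2 * v) - c ^ 2 / 2| ≤ 6 * h := by
    have e1 : z ^ 2 / (2 * v) - c ^ 2 / 2 = (z ^ 2 - c ^ 2 + r ^ 2 * c ^ 2) / (2 * v) := by
      rw [div_sub_div _ _ (by positivity) two_ne_zero,
        div_eq_div_iff (by positivity) (by positivity), hv]
      ring
    rw [e1, abs_div, abs_of_pos (by positivity : 0 < 2 * (v : ℝ)), div_le_iff₀ (by positivity)]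
    have : |z ^ 2 - c ^ 2 + r ^ 2 * c ^ 2| ≤ 10 * h := by
      refine (abs_add_le _ _).trans ?_
      rw [abs_of_nonneg (by positivity : 0 ≤ r ^ 2 * c ^ 2)]
      linarith
    nlinarith
  have hs0 : 0 < √(v : ℝ) := Real.sqrt_pos.2 hv0
  have hs1 : √(v : ℝ) ≤ 1 := Real.sqrt_le_one.2 hv1
  have hs2 : Real.exp (-h) ≤ √(v : ℝ) := by
    refine Real.le_sqrt_of_sq_le ?_
    rw [← Real.exp_nat_mul]
    have e2 : 1 + 2 * h ≤ Real.exp (2 * h) := by linarith [Real.add_one_le_exp (2 * h)]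
    have e3 : Real.exp (((2 : ℕ) : ℝ) * -h) = (Real.exp (2 * h))⁻¹ := by
      rw [← Real.exp_neg]; congr 1; push_cast; ring
    rw [e3, inv_le_comm₀ (Real.exp_pos _) hv0]
    refine le_trans ?_ e2
    rw [inv_le_iff_one_le_mul₀ hv0, hv]
    nlinarith
  have hK : gaussianPDFReal (r * x) v y =
      (√(v : ℝ))⁻¹ * ((√(2 * Real.pi))⁻¹ * Real.exp (-(z ^ 2 / (2 * v)))) := by
    rw [gaussianPDFReal, Real.sqrt_mul (by positivity), mul_inv, neg_div]
    ring
  rw [hK, stdPDF_eq]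
  obtain ⟨hl, hr'⟩ := abs_le.1 hexp
  constructor
  · calc Real.exp (-(6 * h)) * ((√(2 * Real.pi))⁻¹ * Real.exp (-c ^ 2 / 2))
        = 1 * ((√(2 * Real.pi))⁻¹ * Real.exp (-(6 * h) + -c ^ 2 / 2)) := by
          rw [Real.exp_add]; ring
      _ ≤ _ := by
          gcongr
          · exact (one_le_inv₀ hs0).2 hs1
          · linarith
  · calc (√(v : ℝ))⁻¹ * ((√(2 * Real.pi))⁻¹ * Real.exp (-(z ^ 2 / (2 * v))))
        ≤ Real.exp h * ((√(2 * Real.pi))⁻¹ * Real.exp (6 * h + -c ^ 2 / 2)) := by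
          gcongr
          · rw [inv_le_comm₀ hs0 (Real.exp_pos _), ← Real.exp_neg]
            exact hs2
          · linarith
      _ = _ := by
          rw [show 7 * h = h + 6 * h by ring, Real.exp_add, Real.exp_add h]; ring

/-- `-G'` is a probability density on `[c, c + δ]`, so integrating a Gaussian density against it
preserves pointwise bounds. -/
lemma integral_neg_deriv_cutoff_gaussianReal {c δ m lo hi : ℝ} {v : ℝ≥0} (hδ : 0 < δ) (hv : v ≠ 0)
    (h : ∀ y ∈ Set.Icc c (c + δ), lo ≤ gaussianPDFReal m v y ∧ gaussianPDFReal m v y ≤ hi) :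
    lo ≤ ∫ y, -deriv (cutoff c δ) y ∂(gaussianReal m v) ∧
      ∫ y, -deriv (cutoff c δ) y ∂(gaussianReal m v) ≤ hi := by
  have hint : Integrable (fun y ↦ -deriv (cutoff c δ) y) :=
    ((continuous_deriv_cutoff c δ).integrable_of_hasCompactSupport
      (hasCompactSupport_deriv_cutoff hδ)).neg
  have h1 : ∫ y, -deriv (cutoff c δ) y = 1 := by
    rw [integral_neg, integral_deriv_cutoff hδ, neg_neg]
  have hint2 : Integrable (fun y ↦ gaussianPDFReal m v y • -deriv (cutoff c δ) y) := by
    obtain ⟨M, hM⟩ := exists_abs_deriv_cutoff_le (c := c) hδ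
    refine (integrable_gaussianPDFReal m v).mul_bdd (c := M)
      hint.aestronglyMeasurable (.of_forall fun y ↦ ?_)
    rw [norm_neg]
    exact hM y
  rw [integral_gaussianReal_eq_integral_smul hv]
  have hpt (y : ℝ) : lo * -deriv (cutoff c δ) y ≤ gaussianPDFReal m v y • -deriv (cutoff c δ) y ∧
      gaussianPDFReal m v y • -deriv (cutoff c δ) y ≤ hi * -deriv (cutoff c δ) y := by
    rw [smul_eq_mul]
    by_cases hy : y ∈ Set.Icc c (c + δ)
    · have := neg_nonneg.2 (deriv_cutoff_nonpos (c := c) hδ y)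
      exact ⟨mul_le_mul_of_nonneg_right (h y hy).1 this, mul_le_mul_of_nonneg_right (h y hy).2 this⟩
    · simp [deriv_cutoff_eq_zero hδ hy]
  constructor
  · calc lo = ∫ y, lo * -deriv (cutoff c δ) y := by rw [integral_const_mul, h1, mul_one]
      _ ≤ _ := integral_mono (hint.const_mul _) hint2 fun y ↦ (hpt y).1
  · calc _ ≤ ∫ y, hi * -deriv (cutoff c δ) y :=
          integral_mono hint2 (hint.const_mul _) fun y ↦ (hpt y).2
      _ = hi := by rw [integral_const_mul, h1, mul_one]

end Density

section Pair

variable {ι : Type*} [Fintype ι] [DecidableEq ι]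

open scoped NNReal

lemma covariance_eval_sub {S : Matrix ι ι ℝ} (hS : S.PosSemidef) (l i j k : ι) (a b : ℝ) :
    cov[fun x : EuclideanSpace ℝ ι ↦ x l, fun x ↦ x k - a * x i - b * x j;
      multivariateGaussian 0 S] = S l k - a * S l i - b * S l j := by
  have hm (l : ι) : MemLp (fun x : EuclideanSpace ℝ ι ↦ x l) 2 (multivariateGaussian 0 S) :=
    (IsGaussian.hasGaussianLaw_id.map_fun (EuclideanSpace.proj (𝕜 := ℝ) l)).memLp_two
  rw [covariance_fun_sub_right (Y := fun x ↦ x k - a * x i) (Z := fun x ↦ b * x j) (hm l)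
    ((hm k).sub ((hm i).const_mul a)) ((hm j).const_mul b),
    covariance_fun_sub_right (hm l) (hm k) ((hm i).const_mul a), covariance_const_mul_right,
    covariance_const_mul_right]
  simp only [covariance_eval_multivariateGaussian hS]

/-- The coordinates `i` and `j` of a Gaussian vector, integrated against the approximate point
mass at `c`: the result is the joint density at `(c, c)` up to a factor close to one. -/
lemma integral_deriv_cutoff_mul_bounds {S : Matrix ι ι ℝ} (hS : S.PosSemidef)
    (hd : ∀ i, S i i = 1) {c δ h u : ℝ} (hc : 1 ≤ c) (hδ0 : 0 < δ) (hδc : δ ≤ c)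
    (hδ : c * δ ≤ h) (hu : u * c ^ 2 ≤ h) (hh : h ≤ 1 / 4) {i j : ι} (hr : |S i j| ≤ u) :
    Real.exp (-(8 * h)) * stdPDF c ^ 2 ≤
        ∫ x, deriv (cutoff c δ) (x i) * deriv (cutoff c δ) (x j) ∂(multivariateGaussian 0 S) ∧
      ∫ x, deriv (cutoff c δ) (x i) * deriv (cutoff c δ) (x j) ∂(multivariateGaussian 0 S) ≤
        Real.exp (8 * h) * stdPDF c ^ 2 := by
  set μ := multivariateGaussian 0 S with hμ
  set r := S i j
  set p : ℝ → ℝ := fun y ↦ -deriv (cutoff c δ) y with hp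
  have hpc : Continuous p := (continuous_deriv_cutoff c δ).neg
  have hp0 (y : ℝ) : 0 ≤ p y := neg_nonneg.2 (deriv_cutoff_nonpos hδ0 y)
  obtain ⟨M, hM⟩ := exists_abs_deriv_cutoff_le (c := c) hδ0
  have hpM (y : ℝ) : ‖p y‖ ≤ M := by rw [norm_neg]; exact hM y
  have hu0 : 0 ≤ u := (abs_nonneg _).trans hr
  have h0 : 0 ≤ h := le_trans (by positivity) hu
  have huh : u ≤ 1 / 4 := by nlinarith [one_le_pow₀ hc (n := 2)]
  have hr2 : r ^ 2 < 1 := by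
    have : |r| ^ 2 ≤ (1 / 4) ^ 2 := pow_le_pow_left₀ (abs_nonneg _) (hr.trans huh) 2
    rw [sq_abs] at this
    linarith
  have hsym : S j i = r := by simpa using hS.1.apply i j
  set v : ℝ≥0 := ⟨1 - r ^ 2, by linarith⟩
  have hvr : (v : ℝ) = 1 - r ^ 2 := rfl
  have hv0 : v ≠ 0 := by
    rw [← NNReal.coe_ne_zero, hvr]; linarith
  -- `X_i` and the residual `X_j - r X_i` are independent, with variances `1` and `1 - r²`
  set X : EuclideanSpace ℝ ι → ℝ := fun x ↦ x i with hX
  set V : EuclideanSpace ℝ ι → ℝ := fun x ↦ x j - r * x i with hV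
  have hXm : Measurable X := by fun_prop
  have hVm : Measurable V := by fun_prop
  have hgl : HasGaussianLaw (fun x ↦ (X x, V x)) μ :=
    IsGaussian.hasGaussianLaw_id.map_fun (((EuclideanSpace.proj (𝕜 := ℝ) i).prod
      (EuclideanSpace.proj (𝕜 := ℝ) j - r • EuclideanSpace.proj (𝕜 := ℝ) i)) :
        EuclideanSpace ℝ ι →L[ℝ] ℝ × ℝ)
  have hm (l : ι) : MemLp (fun x : EuclideanSpace ℝ ι ↦ x l) 2 μ :=
    (IsGaussian.hasGaussianLaw_id.map_fun (EuclideanSpace.proj (𝕜 := ℝ) l)).memLp_two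
  have hcov : cov[X, V; μ] = 0 := by
    have := covariance_eval_sub hS i i i j r 0
    simp only [zero_mul, sub_zero] at this
    rw [hX, hV, hμ, this, hd]
    ring
  have hind : IndepFun X V μ := hgl.indepFun_of_covariance_eq_zero hcov
  have hXlaw : μ.map X = gaussianReal 0 1 := (measurePreserving_eval_of_diag hS (hd i)).map_eq
  have hVlaw : μ.map V = gaussianReal 0 v := by
    rw [hgl.snd.map_eq_gaussianReal]
    congr 1
    · have : ∀ l, ∫ x : EuclideanSpace ℝ ι, x l ∂μ = 0 := fun l ↦ by
        have h2 : ∫ y, y ∂(μ.map fun x : EuclideanSpace ℝ ι ↦ x l) = 0 := by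
          rw [(measurePreserving_eval_of_diag hS (hd l)).map_eq, integral_id_gaussianReal]
        rwa [integral_map (by fun_prop) (by fun_prop)] at h2
      rw [hV, integral_sub ((hm j).integrable (by norm_num))
        (((hm i).const_mul r).integrable (by norm_num)), integral_const_mul, this, this]
      simp
    · have e1 : Var[V; μ] = 1 - r ^ 2 := by
        rw [hV, variance_fun_sub (hm j) ((hm i).const_mul r), variance_const_mul,
          covariance_const_mul_right]
        rw [variance_eval_multivariateGaussian hS, variance_eval_multivariateGaussian hS,
          covariance_eval_multivariateGaussian hS, hd, hd, hsym]
        ring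
      rw [e1]
      exact Real.toNNReal_of_nonneg (by linarith)
  have hjoint : μ.map (fun x ↦ (X x, V x)) = (gaussianReal 0 1).prod (gaussianReal 0 v) := by
    rw [(indepFun_iff_map_prod_eq_prod_map_map hXm.aemeasurable hVm.aemeasurable).1 hind, hXlaw,
      hVlaw]
  have hFc : Continuous fun z : ℝ × ℝ ↦ p z.1 * p (z.2 + r * z.1) := by fun_prop
  have hFint : Integrable (fun z : ℝ × ℝ ↦ p z.1 * p (z.2 + r * z.1))
      ((gaussianReal 0 1).prod (gaussianReal 0 v)) := by
    refine .of_bound hFc.aestronglyMeasurable (M * M) (.of_forall fun z ↦ ?_)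
    rw [norm_mul]
    exact mul_le_mul (hpM _) (hpM _) (norm_nonneg _) ((norm_nonneg _).trans (hpM 0))
  have hE : ∫ x, deriv (cutoff c δ) (x i) * deriv (cutoff c δ) (x j) ∂μ =
      ∫ s, p s * ∫ y, p y ∂(gaussianReal (r * s) v) ∂(gaussianReal 0 1) := by
    have e1 : ∫ x, deriv (cutoff c δ) (x i) * deriv (cutoff c δ) (x j) ∂μ =
        ∫ z, p z.1 * p (z.2 + r * z.1) ∂(μ.map fun x ↦ (X x, V x)) := by
      rw [integral_map (hXm.prodMk hVm).aemeasurable hFc.aestronglyMeasurable]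
      refine integral_congr_ae (.of_forall fun x ↦ ?_)
      simp [hp, hX, hV]
    rw [e1, hjoint, integral_prod _ hFint]
    refine integral_congr_ae (.of_forall fun s ↦ ?_)
    simp only
    rw [integral_const_mul]
    congr 1
    have e2 : gaussianReal (r * s) v = (gaussianReal 0 v).map (· + r * s) := by
      rw [gaussianReal_map_add_const, zero_add]
    rw [e2, integral_map (by fun_prop) hpc.aestronglyMeasurable]
  have hI {s : ℝ} (hs : s ∈ Set.Icc c (c + δ)) :=
    integral_neg_deriv_cutoff_gaussianReal hδ0 hv0
      fun y hy ↦ gaussianPDFReal_le_and_le hc hδc hδ hr hu hh hvr hs hy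
  have hO := integral_neg_deriv_cutoff_gaussianReal (c := c) (δ := δ) (m := 0) hδ0 one_ne_zero
    fun y hy ↦ ⟨le_stdPDF hδc hδ hy, stdPDF_le (by linarith) hy.1⟩
  have hpI : Integrable p (gaussianReal 0 1) :=
    .of_bound hpc.aestronglyMeasurable M (.of_forall hpM)
  have hpt (s : ℝ) : p s * (Real.exp (-(6 * h)) * stdPDF c) ≤
      p s * ∫ y, p y ∂(gaussianReal (r * s) v) ∧ p s * ∫ y, p y ∂(gaussianReal (r * s) v) ≤
      p s * (Real.exp (7 * h) * stdPDF c) := by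
    by_cases hs : s ∈ Set.Icc c (c + δ)
    · exact ⟨mul_le_mul_of_nonneg_left (hI hs).1 (hp0 s),
        mul_le_mul_of_nonneg_left (hI hs).2 (hp0 s)⟩
    · simp [hp, deriv_cutoff_eq_zero hδ0 hs]
  have hGint : Integrable (fun s ↦ p s * ∫ y, p y ∂(gaussianReal (r * s) v))
      (gaussianReal 0 1) := by
    have h3 := hFint.integral_prod_left
    refine h3.congr (.of_forall fun s ↦ ?_)
    simp only
    rw [integral_const_mul]
    congr 1
    have e2 : gaussianReal (r * s) v = (gaussianReal 0 v).map (· + r * s) := by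
      rw [gaussianReal_map_add_const, zero_add]
    rw [e2, integral_map (by fun_prop) hpc.aestronglyMeasurable]
  have hφ := (stdPDF_pos c).le
  rw [hE]
  constructor
  · calc Real.exp (-(8 * h)) * stdPDF c ^ 2
        = (Real.exp (-(2 * h)) * stdPDF c) * (Real.exp (-(6 * h)) * stdPDF c) := by
          rw [show -(8 * h) = -(2 * h) + -(6 * h) by ring, Real.exp_add]; ring
      _ ≤ (∫ s, p s ∂(gaussianReal 0 1)) * (Real.exp (-(6 * h)) * stdPDF c) :=
          mul_le_mul_of_nonneg_right hO.1 (by positivity)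
      _ = ∫ s, p s * (Real.exp (-(6 * h)) * stdPDF c) ∂(gaussianReal 0 1) :=
          (integral_mul_const _ _).symm
      _ ≤ _ := integral_mono (hpI.mul_const _) hGint fun s ↦ (hpt s).1
  · calc _ ≤ ∫ s, p s * (Real.exp (7 * h) * stdPDF c) ∂(gaussianReal 0 1) :=
          integral_mono hGint (hpI.mul_const _) fun s ↦ (hpt s).2
      _ = (∫ s, p s ∂(gaussianReal 0 1)) * (Real.exp (7 * h) * stdPDF c) := integral_mul_const _ _
      _ ≤ stdPDF c * (Real.exp (7 * h) * stdPDF c) :=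
          mul_le_mul_of_nonneg_right hO.2 (by positivity)
      _ = Real.exp (7 * h) * stdPDF c ^ 2 := by ring
      _ ≤ _ := by gcongr; linarith

end Pair

/-! ### Conditioning on two coordinates -/

section Conditioning

lemma measurableSet_forall_le {ι Ω : Type*} [Countable ι] [MeasurableSpace Ω] {X : ι → Ω → ℝ}
    (hX : ∀ k, Measurable (X k)) (s : Finset ι) (a : ℝ) :
    MeasurableSet {z | ∀ k ∈ s, X k z ≤ a} := by
  simp only [Set.ofPred_forall]
  exact .iInter fun k ↦ .iInter fun _ ↦ hX k measurableSet_Iic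

variable {ι : Type*} [Fintype ι] [DecidableEq ι]

/-- Linear regression on `X_i` and `X_j`: the residuals `X_k - a_k X_i - b_k X_j` are independent of
`(X_i, X_j)`, with small coefficients. The residuals of `X_i` and `X_j` themselves are zero, so no
index needs to be excluded. -/
lemma exists_regression {S : Matrix ι ι ℝ} (hS : S.PosSemidef) (hd : ∀ i, S i i = 1) {u : ℝ}
    (hu : ∀ k l, k ≠ l → |S k l| ≤ u) (hu2 : u ≤ 1 / 4) {i j : ι} (hij : i ≠ j) :
    ∃ a b : ι → ℝ, (∀ k ∈ ({i, j} : Finset ι)ᶜ, |a k| ≤ 2 * u ∧ |b k| ≤ 2 * u) ∧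
      IndepFun (fun (x : EuclideanSpace ℝ ι) (l : Fin 2) ↦ x (![i, j] l))
        (fun (x : EuclideanSpace ℝ ι) (k : ι) ↦ x k - a k * x i - b k * x j)
        (multivariateGaussian 0 S) := by
  set r := S i j with hr
  have hsym : S j i = r := by simpa using hS.1.apply i j
  have hru : |r| ≤ u := hu i j hij
  have hu0 : 0 ≤ u := (abs_nonneg _).trans hru
  have hr2 : r ^ 2 ≤ u ^ 2 := sq_le_sq' (neg_le_of_abs_le hru) (le_of_abs_le hru)
  have hpos : 0 < 1 - r ^ 2 := by nlinarith
  have hbd {s t : ℝ} (hs : |s| ≤ u) (ht : |t| ≤ u) : |(s - r * t) / (1 - r ^ 2)| ≤ 2 * u := by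
    rw [abs_div, abs_of_pos hpos, div_le_iff₀ hpos]
    have h1 : |s - r * t| ≤ u + u * u := by
      refine (abs_sub _ _).trans (add_le_add hs ?_)
      rw [abs_mul]
      exact mul_le_mul hru ht (abs_nonneg _) hu0
    nlinarith
  set a : ι → ℝ := fun k ↦ (S i k - r * S j k) / (1 - r ^ 2) with ha
  set b : ι → ℝ := fun k ↦ (S j k - r * S i k) / (1 - r ^ 2) with hb
  refine ⟨a, b, fun k hk ↦ ?_, ?_⟩
  · simp only [Finset.mem_compl, Finset.mem_insert, Finset.mem_singleton, not_or] at hk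
    have h1 := hu i k (Ne.symm hk.1)
    have h2 := hu j k (Ne.symm hk.2)
    exact ⟨hbd h1 h2, hbd h2 h1⟩
  · have hgl : HasGaussianLaw (fun x : EuclideanSpace ℝ ι ↦ ((fun l : Fin 2 ↦ x (![i, j] l)),
        fun k : ι ↦ x k - a k * x i - b k * x j)) (multivariateGaussian 0 S) :=
      IsGaussian.hasGaussianLaw_id.map_fun
        (((ContinuousLinearMap.pi fun l : Fin 2 ↦ EuclideanSpace.proj (𝕜 := ℝ) (![i, j] l)).prod
          (ContinuousLinearMap.pi fun k ↦ EuclideanSpace.proj (𝕜 := ℝ) k -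
            a k • EuclideanSpace.proj (𝕜 := ℝ) i - b k • EuclideanSpace.proj (𝕜 := ℝ) j)) :
          EuclideanSpace ℝ ι →L[ℝ] (Fin 2 → ℝ) × (ι → ℝ))
    refine hgl.indepFun_of_covariance_eval fun l k ↦ ?_
    rw [covariance_eval_sub hS]
    fin_cases l
    · change S i k - a k * S i i - b k * S i j = 0
      rw [hd, ← hr, ha, hb]
      field_simp
      ring
    · change S j k - a k * S j i - b k * S j j = 0
      rw [hd, hsym, ha, hb]
      field_simp
      ring

lemma measureReal_lt_abs_eval_le {S : Matrix ι ι ℝ} (hS : S.PosSemidef) {i : ι} (hd : S i i = 1)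
    (c : ℝ) :
    (multivariateGaussian 0 S).real {x : EuclideanSpace ℝ ι | c < |x i|} ≤
      2 * cdf (gaussianReal 0 1) (-c) := by
  have h1 : (multivariateGaussian 0 S).real {x : EuclideanSpace ℝ ι | c < |x i|} =
      (gaussianReal 0 1).real {y | c < |y|} :=
    (measurePreserving_eval_of_diag hS hd).measureReal_preimage
      (measurableSet_lt measurable_const measurable_norm).nullMeasurableSet
  have h2 : {y : ℝ | c < |y|} ⊆ Set.Iic (-c) ∪ (fun y ↦ -y) ⁻¹' Set.Iic (-c) := by
    intro y hy
    rcases lt_abs.1 (show c < |y| from hy) with h | h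
    · exact .inr (by simpa using h.le)
    · exact .inl (by simpa using le_neg_of_le_neg h.le)
  have h3 : (gaussianReal 0 1).real ((fun y ↦ -y) ⁻¹' Set.Iic (-c)) =
      (gaussianReal 0 1).real (Set.Iic (-c)) := by
    rw [← map_measureReal_apply measurable_neg measurableSet_Iic, gaussianReal_map_neg, neg_zero]
  rw [h1, cdf_eq_real, two_mul]
  refine (measureReal_mono h2).trans ((measureReal_union_le _ _).trans ?_)
  rw [h3]

/-- The smooth pair integrals factor approximately into the joint density of two coordinates at
`(c, c)` and the orthant probability: conditioning on two weakly correlated coordinates perturbs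
the thresholds of the others only slightly. -/
theorem pairIntegral_bounds {S : Matrix ι ι ℝ} (hS : S.PosSemidef) (hd : ∀ i, S i i = 1)
    {c δ h u η : ℝ} (hu : ∀ k l, k ≠ l → |S k l| ≤ u) (hc : 1 ≤ c) (hδ0 : 0 < δ) (hδc : δ ≤ c)
    (hδ : c * δ ≤ h) (huc : u * c ^ 2 ≤ h) (hh : h ≤ 1 / 4) (hη : δ + 12 * u * c ≤ η)
    {i j : ι} (hij : i ≠ j) :
    Real.exp (-(8 * h)) * stdPDF c ^ 2 *
        (orthantProb S (c - η) - 4 * cdf (gaussianReal 0 1) (-c)) ≤ pairIntegral S c δ i j ∧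
      pairIntegral S c δ i j ≤ Real.exp (8 * h) * stdPDF c ^ 2 *
        (orthantProb S (c + η) + 4 * cdf (gaussianReal 0 1) (-c)) := by
  set μ := multivariateGaussian 0 S with hμ
  have hu0 : 0 ≤ u := (abs_nonneg _).trans (hu i j hij)
  have huh : u ≤ h := (le_mul_of_one_le_right hu0 (one_le_pow₀ hc)).trans huc
  obtain ⟨hlo, hhi⟩ := integral_deriv_cutoff_mul_bounds hS hd hc hδ0 hδc hδ huc hh (hu i j hij)
  obtain ⟨a, b, hab, hind⟩ := exists_regression hS hd hu (huh.trans hh) hij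
  set W : ι → EuclideanSpace ℝ ι → ℝ := fun k x ↦ x k - a k * x i - b k * x j with hW
  have hWm (k : ι) : Measurable (W k) := by fun_prop
  set B : ℝ → Set (EuclideanSpace ℝ ι) := fun s ↦ {x | ∀ k ∈ ({i, j} : Finset ι)ᶜ, W k x ≤ s}
    with hB
  have hBm (s : ℝ) : MeasurableSet (B s) := measurableSet_forall_le hWm _ s
  set q : EuclideanSpace ℝ ι → ℝ := fun x ↦ deriv (cutoff c δ) (x i) * deriv (cutoff c δ) (x j)
    with hq
  have hqc : Continuous q := by
    have := continuous_deriv_cutoff c δ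
    fun_prop
  have hq0 (x : EuclideanSpace ℝ ι) : 0 ≤ q x :=
    mul_nonneg_of_nonpos_of_nonpos (deriv_cutoff_nonpos hδ0 _) (deriv_cutoff_nonpos hδ0 _)
  obtain ⟨M, hM⟩ := exists_abs_deriv_cutoff_le (c := c) hδ0
  have hqM (x : EuclideanSpace ℝ ι) : ‖q x‖ ≤ M * M := by
    rw [norm_mul]
    exact mul_le_mul (hM _) (hM _) (norm_nonneg _) ((abs_nonneg _).trans (hM 0))
  have hqint : Integrable q μ := .of_bound hqc.aestronglyMeasurable (M * M) (.of_forall hqM)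
  have hfac (s : ℝ) : ∫ x, q x * (B s).indicator (fun _ ↦ (1 : ℝ)) x ∂μ =
      (∫ x, q x ∂μ) * μ.real (B s) := by
    set C : Set (ι → ℝ) := {w | ∀ k ∈ ({i, j} : Finset ι)ᶜ, w k ≤ s}
    have hCm : MeasurableSet C := measurableSet_forall_le (fun k ↦ measurable_pi_apply k) _ s
    have hm1 : Measurable fun z : Fin 2 → ℝ ↦
        deriv (cutoff c δ) (z 0) * deriv (cutoff c δ) (z 1) := by
      have := (continuous_deriv_cutoff c δ).measurable
      fun_prop
    have hm2 : Measurable (C.indicator fun _ ↦ (1 : ℝ)) := measurable_const.indicator hCm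
    have hind2 := hind.comp hm1 hm2
    have h1 := hind2.integral_fun_mul_eq_mul_integral hqc.aestronglyMeasurable
      (hm2.comp (measurable_pi_lambda _ hWm)).aestronglyMeasurable
    have h2 : ∫ x, (B s).indicator (fun _ ↦ (1 : ℝ)) x ∂μ = μ.real (B s) := by
      rw [integral_indicator_const _ (hBm s), smul_eq_mul, mul_one]
    rw [← h2]
    exact h1
  set T : Set (EuclideanSpace ℝ ι) := {x | c < |x i|} ∪ {x | c < |x j|} with hT
  have hTle : μ.real T ≤ 4 * cdf (gaussianReal 0 1) (-c) := by
    refine (measureReal_union_le _ _).trans ?_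
    linarith [measureReal_lt_abs_eval_le hS (hd i) c, measureReal_lt_abs_eval_le hS (hd j) c]
  have habx {k : ι} (hk : k ∈ ({i, j} : Finset ι)ᶜ) {s : ℝ} {x : EuclideanSpace ℝ ι} (hs : 0 ≤ s)
      (hi : |x i| ≤ s) (hj : |x j| ≤ s) : |a k * x i + b k * x j| ≤ 4 * u * s := by
    refine (abs_add_le _ _).trans ?_
    rw [abs_mul, abs_mul]
    have h1 := mul_le_mul (hab k hk).1 hi (abs_nonneg _) (by positivity)
    have h2 := mul_le_mul (hab k hk).2 hj (abs_nonneg _) (by positivity)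
    linarith
  have huc0 : 0 ≤ u * c := by positivity
  have huδ : u * (c + δ) ≤ 2 * (u * c) := by nlinarith
  -- unless `|X_i|` or `|X_j|` exceeds `c`, residuals and coordinates differ by at most `4uc`, so
  -- the residual events are compared with orthant events for the unconditioned vector
  have hup : μ.real (B (c + (δ + 8 * u * c))) ≤
      orthantProb S (c + η) + 4 * cdf (gaussianReal 0 1) (-c) := by
    have hsub : B (c + (δ + 8 * u * c)) ⊆ {x | ∀ k, x k ≤ c + η} ∪ T := by
      intro x hx
      by_cases hxT : x ∈ T
      · exact .inr hxT
      · refine .inl fun k ↦ ?_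
        simp only [hT, Set.mem_union, Set.mem_ofPred_eq, not_or, not_lt] at hxT
        by_cases hk : k ∈ ({i, j} : Finset ι)ᶜ
        · have h1 := hx k hk
          have h2 := (abs_le.1 (habx hk (by linarith) hxT.1 hxT.2)).2
          simp only [hW] at h1
          linarith
        · simp only [Finset.mem_compl, Finset.mem_insert, Finset.mem_singleton, not_not] at hk
          rcases hk with rfl | rfl
          · linarith [le_abs_self (x k)]
          · linarith [le_abs_self (x k)]
    refine (measureReal_mono hsub).trans ((measureReal_union_le _ _).trans ?_)
    exact add_le_add le_rfl hTle
  have hdown : orthantProb S (c - η) - 4 * cdf (gaussianReal 0 1) (-c) ≤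
      μ.real (B (c - 8 * u * c)) := by
    have hsub : {x : EuclideanSpace ℝ ι | ∀ k, x k ≤ c - η} ⊆ B (c - 8 * u * c) ∪ T := by
      intro x hx
      by_cases hxT : x ∈ T
      · exact .inr hxT
      · refine .inl fun k hk ↦ ?_
        simp only [hT, Set.mem_union, Set.mem_ofPred_eq, not_or, not_lt] at hxT
        have h1 := hx k
        have h2 := (abs_le.1 (habx hk (by linarith) hxT.1 hxT.2)).1
        simp only [hW]
        linarith
    rw [sub_le_iff_le_add]
    refine (measureReal_mono hsub).trans ((measureReal_union_le _ _).trans ?_)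
    exact add_le_add le_rfl hTle
  -- on the support of the density factor, both coordinates lie in `[c, c + δ]`
  have hsupp {x : EuclideanSpace ℝ ι} (hx : q x ≠ 0) :
      |x i| ≤ c + δ ∧ |x j| ≤ c + δ := by
    have hi : x i ∈ Set.Icc c (c + δ) := by
      by_contra hn
      exact hx (by simp [hq, deriv_cutoff_eq_zero hδ0 hn])
    have hj : x j ∈ Set.Icc c (c + δ) := by
      by_contra hn
      exact hx (by simp [hq, deriv_cutoff_eq_zero hδ0 hn])
    rw [abs_of_nonneg (by linarith [hi.1]), abs_of_nonneg (by linarith [hj.1])]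
    exact ⟨hi.2, hj.2⟩
  have hpr0 (x : EuclideanSpace ℝ ι) : 0 ≤ ∏ k ∈ ({i, j} : Finset ι)ᶜ, cutoff c δ (x k) :=
    Finset.prod_nonneg fun k _ ↦ cutoff_nonneg _ _ _
  have hpr1 (x : EuclideanSpace ℝ ι) : ∏ k ∈ ({i, j} : Finset ι)ᶜ, cutoff c δ (x k) ≤ 1 :=
    Finset.prod_le_one (fun k _ ↦ cutoff_nonneg _ _ _) fun k _ ↦ cutoff_le_one _ _ _
  have hle1 (x : EuclideanSpace ℝ ι) : q x * (B (c - 8 * u * c)).indicator (fun _ ↦ (1 : ℝ)) x ≤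
      q x * ∏ k ∈ ({i, j} : Finset ι)ᶜ, cutoff c δ (x k) := by
    by_cases hx : q x = 0
    · simp [hx]
    refine mul_le_mul_of_nonneg_left ?_ (hq0 x)
    by_cases hxB : x ∈ B (c - 8 * u * c)
    · rw [Set.indicator_of_mem hxB]
      refine (Finset.prod_eq_one fun k hk ↦ cutoff_eq_one hδ0 ?_).ge
      have h1 := hxB k hk
      have h2 := (abs_le.1 (habx hk (by linarith) (hsupp hx).1 (hsupp hx).2)).2
      simp only [hW] at h1
      linarith
    · rw [Set.indicator_of_notMem hxB]
      exact hpr0 x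
  have hle2 (x : EuclideanSpace ℝ ι) : q x * ∏ k ∈ ({i, j} : Finset ι)ᶜ, cutoff c δ (x k) ≤
      q x * (B (c + (δ + 8 * u * c))).indicator (fun _ ↦ (1 : ℝ)) x := by
    by_cases hx : q x = 0
    · simp [hx]
    refine mul_le_mul_of_nonneg_left ?_ (hq0 x)
    by_cases hxB : x ∈ B (c + (δ + 8 * u * c))
    · rw [Set.indicator_of_mem hxB]
      exact hpr1 x
    · rw [Set.indicator_of_notMem hxB]
      simp only [hB, Set.mem_ofPred_eq, not_forall, not_le] at hxB
      obtain ⟨k, hk, hk2⟩ := hxB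
      refine (Finset.prod_eq_zero hk (cutoff_eq_zero hδ0 ?_)).le
      have h2 := (abs_le.1 (habx hk (by linarith) (hsupp hx).1 (hsupp hx).2)).1
      simp only [hW] at hk2
      linarith
  have hint1 (s : ℝ) : Integrable (fun x ↦ q x * (B s).indicator (fun _ ↦ (1 : ℝ)) x) μ := by
    refine hqint.mul_bdd (c := 1)
      ((measurable_const.indicator (hBm s)).aestronglyMeasurable) (.of_forall fun x ↦ ?_)
    by_cases hx : x ∈ B s
    · simp [hx]
    · simp [hx]
  have hint2 : Integrable (fun x ↦ q x * ∏ k ∈ ({i, j} : Finset ι)ᶜ, cutoff c δ (x k)) μ := by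
    refine hqint.mul_bdd (c := 1) (Continuous.aestronglyMeasurable ?_) (.of_forall fun x ↦ ?_)
    · have := continuous_cutoff c δ
      fun_prop
    · rw [Real.norm_eq_abs, abs_of_nonneg (hpr0 x)]
      exact hpr1 x
  constructor
  · calc _ ≤ Real.exp (-(8 * h)) * stdPDF c ^ 2 * μ.real (B (c - 8 * u * c)) := by gcongr
      _ ≤ (∫ x, q x ∂μ) * μ.real (B (c - 8 * u * c)) := by gcongr
      _ = ∫ x, q x * (B (c - 8 * u * c)).indicator (fun _ ↦ (1 : ℝ)) x ∂μ := (hfac _).symm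
      _ ≤ pairIntegral S c δ i j := integral_mono (hint1 _) hint2 hle1
  · calc pairIntegral S c δ i j ≤ ∫ x, q x * (B (c + (δ + 8 * u * c))).indicator
          (fun _ ↦ (1 : ℝ)) x ∂μ := integral_mono hint2 (hint1 _) hle2
      _ = (∫ x, q x ∂μ) * μ.real (B (c + (δ + 8 * u * c))) := hfac _
      _ ≤ Real.exp (8 * h) * stdPDF c ^ 2 * μ.real (B (c + (δ + 8 * u * c))) := by gcongr
      _ ≤ _ := by gcongr

end Conditioning

/-! ### The normal tail and the thresholds -/

section Tail

/-- The upper tail probability of the standard normal distribution, `Φ(-x)`. -/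
noncomputable def normalTail (x : ℝ) : ℝ := cdf (gaussianReal 0 1) (-x)

lemma normalTail_antitone : Antitone normalTail :=
  fun _ _ h ↦ monotone_cdf _ (neg_le_neg h)

lemma normalTail_nonneg (x : ℝ) : 0 ≤ normalTail x := cdf_nonneg _ _

lemma stdPDF_neg (x : ℝ) : stdPDF (-x) = stdPDF x := by simp [stdPDF_eq]

lemma continuous_stdPDF : Continuous stdPDF := by
  have : stdPDF = fun x ↦ (√(2 * Real.pi))⁻¹ * Real.exp (-x ^ 2 / 2) := funext stdPDF_eq
  rw [this]
  fun_prop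

lemma integrable_stdPDF : Integrable stdPDF := integrable_gaussianPDFReal 0 1

lemma hasDerivAt_stdPDF (x : ℝ) : HasDerivAt stdPDF (-x * stdPDF x) x := by
  have : stdPDF = fun x ↦ (√(2 * Real.pi))⁻¹ * Real.exp (-x ^ 2 / 2) := funext stdPDF_eq
  rw [this]
  have h := ((((hasDerivAt_id x).pow 2).neg.div_const 2).exp).const_mul (√(2 * Real.pi))⁻¹
  refine h.congr_deriv ?_
  simp
  ring

lemma normalTail_eq_integral (c : ℝ) : normalTail c = ∫ x in Set.Iic (-c), stdPDF x := by
  rw [normalTail, cdf_eq_real, measureReal_def, gaussianReal_apply_eq_integral _ one_ne_zero,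
    ENNReal.toReal_ofReal (integral_nonneg fun x ↦ gaussianPDFReal_nonneg _ _ _)]
  rfl

/-- The function `-φ(x) / x` has derivative `φ(x) (1 + x⁻²)`; this one identity yields both bounds
on the Mills ratio. -/
lemma integral_stdPDF_mul_eq {c : ℝ} (hc : 0 < c) :
    IntegrableOn (fun x ↦ stdPDF x * (1 + (x ^ 2)⁻¹)) (Set.Iic (-c)) ∧
    ∫ x in Set.Iic (-c), stdPDF x * (1 + (x ^ 2)⁻¹) = stdPDF c / c := by
  have hint : IntegrableOn (fun x ↦ stdPDF x * (1 + (x ^ 2)⁻¹)) (Set.Iic (-c)) := by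
    refine Integrable.mono' (integrable_stdPDF.integrableOn.mul_const (1 + (c ^ 2)⁻¹)) ?_ ?_
    · exact (continuous_stdPDF.measurable.mul (by fun_prop)).aestronglyMeasurable
    · refine (ae_restrict_iff' measurableSet_Iic).2 (.of_forall fun x hx ↦ ?_)
      have hx' : c ≤ -x := le_neg_of_le_neg hx
      rw [Real.norm_eq_abs, abs_of_nonneg (mul_nonneg (stdPDF_pos x).le (by positivity))]
      have : c ^ 2 ≤ x ^ 2 := by nlinarith
      have := stdPDF_pos x
      gcongr
  refine ⟨hint, ?_⟩
  have hlim : Tendsto (fun x ↦ stdPDF x / -x) atBot (𝓝 0) := by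
    refine squeeze_zero' ?_ ?_ ((tendsto_inv_atTop_zero.comp tendsto_neg_atBot_atTop).const_mul
      (stdPDF 0) |>.trans (by simp))
    · filter_upwards [eventually_lt_atBot 0] with x hx
      exact div_nonneg (stdPDF_pos x).le (by linarith)
    · filter_upwards [eventually_lt_atBot 0] with x hx
      rw [div_eq_mul_inv]
      have h1 : stdPDF x ≤ stdPDF 0 := by
        rw [← stdPDF_neg]; exact stdPDF_le le_rfl (by linarith)
      exact mul_le_mul_of_nonneg_right h1 (inv_nonneg.2 (by linarith))
  have h := integral_Iic_of_hasDerivAt_of_tendsto' (f := fun x ↦ stdPDF x / -x) (a := -c) (m := 0)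
    (f' := fun x ↦ stdPDF x * (1 + (x ^ 2)⁻¹)) (fun x hx ↦ ?_) hint hlim
  · rw [h, stdPDF_neg]; simp
  · have hx0 : x ≠ 0 := by
      have : x ≤ -c := hx
      linarith
    refine ((hasDerivAt_stdPDF x).div (hasDerivAt_neg x) (neg_ne_zero.2 hx0)).congr_deriv ?_
    field_simp
    ring

lemma normalTail_le {c : ℝ} (hc : 0 < c) : normalTail c ≤ stdPDF c / c := by
  obtain ⟨h1, h2⟩ := integral_stdPDF_mul_eq hc
  rw [normalTail_eq_integral, ← h2]
  refine integral_mono integrable_stdPDF.integrableOn h1 fun x ↦ ?_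
  exact le_mul_of_one_le_right (stdPDF_pos x).le (le_add_of_nonneg_right (by positivity))

lemma le_normalTail {c : ℝ} (hc : 0 < c) : stdPDF c / c ≤ normalTail c * (1 + (c ^ 2)⁻¹) := by
  obtain ⟨h1, h2⟩ := integral_stdPDF_mul_eq hc
  rw [normalTail_eq_integral, ← h2, ← integral_mul_const]
  refine setIntegral_mono_on h1 (integrable_stdPDF.integrableOn.mul_const _) measurableSet_Iic
    fun x hx ↦ ?_
  have hx' : c ≤ -x := le_neg_of_le_neg hx
  have : c ^ 2 ≤ x ^ 2 := by nlinarith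
  have := stdPDF_pos x
  gcongr

lemma normalTail_pos (x : ℝ) : 0 < normalTail x := by
  have h1 : (0 : ℝ) < max x 1 := lt_max_of_lt_right one_pos
  refine lt_of_lt_of_le ?_ (normalTail_antitone (le_max_left x 1))
  have h := le_normalTail h1
  have h2 : 0 < stdPDF (max x 1) / max x 1 := div_pos (stdPDF_pos _) h1
  exact pos_of_mul_pos_left (h2.trans_le h) (by positivity)

/-- The Mills ratio asymptotics `Φ(-x) ~ φ(x) / x`. -/
lemma tendsto_mills : Tendsto (fun x ↦ stdPDF x / x / normalTail x) atTop (𝓝 1) := by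
  have h1 : Tendsto (fun x : ℝ ↦ 1 + (x ^ 2)⁻¹) atTop (𝓝 1) := by
    simpa using (tendsto_inv_atTop_zero.comp (tendsto_pow_atTop (α := ℝ) two_ne_zero)).const_add 1
  refine tendsto_of_tendsto_of_tendsto_of_le_of_le' tendsto_const_nhds h1 ?_ ?_
  · filter_upwards [eventually_gt_atTop 0] with x hx
    rw [le_div_iff₀ (normalTail_pos x), one_mul]
    exact normalTail_le hx
  · filter_upwards [eventually_gt_atTop 0] with x hx
    rw [div_le_iff₀ (normalTail_pos x), mul_comm]
    exact le_normalTail hx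

end Tail

section Thresholds

variable {α : ℝ} {c : ℕ → ℝ}

lemma BonferroniThresholds.tendsto_normalTail (h : BonferroniThresholds α c) :
    Tendsto (fun n : ℕ ↦ (n : ℝ) * normalTail (c n)) atTop (𝓝 α) := h

lemma BonferroniThresholds.tendsto_normalTail_zero (h : BonferroniThresholds α c) :
    Tendsto (fun n : ℕ ↦ normalTail (c n)) atTop (𝓝 0) := by
  have h1 := h.tendsto_normalTail.mul (tendsto_inv_atTop_zero.comp
    (tendsto_natCast_atTop_atTop (R := ℝ)))
  rw [mul_zero] at h1
  refine h1.congr' ?_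
  filter_upwards [eventually_gt_atTop 0] with n hn
  have : (n : ℝ) ≠ 0 := by positivity
  simp only [Function.comp_apply]
  field_simp

lemma BonferroniThresholds.tendsto_atTop (h : BonferroniThresholds α c) :
    Tendsto c atTop atTop := by
  rw [Filter.tendsto_atTop]
  intro A
  filter_upwards [h.tendsto_normalTail_zero.eventually_lt_const (normalTail_pos A)] with n hn
  by_contra! hlt
  exact absurd (normalTail_antitone hlt.le) (not_le.2 hn)

lemma BonferroniThresholds.tendsto_stdPDF_div (h : BonferroniThresholds α c) :
    Tendsto (fun n : ℕ ↦ (n : ℝ) * (stdPDF (c n) / c n)) atTop (𝓝 α) := by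
  have h1 := h.tendsto_normalTail.mul (tendsto_mills.comp h.tendsto_atTop)
  rw [mul_one] at h1
  refine h1.congr fun n ↦ ?_
  have := (normalTail_pos (c n)).ne'
  simp only [Function.comp_apply]
  field_simp

lemma bonferroniThresholds_of_tendsto_stdPDF_div (hc : Tendsto c atTop atTop)
    (h : Tendsto (fun n : ℕ ↦ (n : ℝ) * (stdPDF (c n) / c n)) atTop (𝓝 α)) :
    BonferroniThresholds α c := by
  have h1 := h.div (tendsto_mills.comp hc) one_ne_zero
  rw [div_one] at h1
  refine h1.congr' ?_
  filter_upwards [hc.eventually_gt_atTop 0] with n hn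
  have h2 := (normalTail_pos (c n)).ne'
  have h3 := (stdPDF_pos (c n)).ne'
  change (n : ℝ) * (stdPDF (c n) / c n) / (stdPDF (c n) / c n / normalTail (c n)) =
    n * normalTail (c n)
  field_simp

/-- The limiting expected number of exceedances is unchanged by a perturbation of the thresholds
of order `o(1 / c_n)`. -/
lemma BonferroniThresholds.add (h : BonferroniThresholds α c) {η : ℕ → ℝ}
    (hη : Tendsto (fun n ↦ c n * η n) atTop (𝓝 0)) :
    BonferroniThresholds α (fun n ↦ c n + η n) := by
  have hc := h.tendsto_atTop
  have hinv : Tendsto (fun n ↦ (c n)⁻¹) atTop (𝓝 0) := tendsto_inv_atTop_zero.comp hc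
  have hη0 : Tendsto η atTop (𝓝 0) := by
    have := hη.mul hinv
    rw [mul_zero] at this
    refine this.congr' ?_
    filter_upwards [hc.eventually_gt_atTop 0] with n hn
    field_simp
  refine bonferroniThresholds_of_tendsto_stdPDF_div (hc.atTop_add hη0) ?_
  have h1 : Tendsto (fun n ↦ Real.exp (-(c n * η n) - η n ^ 2 / 2)) atTop (𝓝 1) := by
    have := (Real.continuous_exp.tendsto _).comp ((hη.neg).sub ((hη0.pow 2).div_const 2))
    simpa [Function.comp_def] using this
  have h2 : Tendsto (fun n ↦ (1 + η n * (c n)⁻¹)⁻¹) atTop (𝓝 1) := by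
    have := ((hη0.mul hinv).const_add 1).inv₀ (by simp)
    simpa using this
  have h3 := (h.tendsto_stdPDF_div.mul h1).mul h2
  simp only [mul_one] at h3
  refine h3.congr' ?_
  filter_upwards [hc.eventually_gt_atTop 0] with n hn
  have e1 : stdPDF (c n + η n) = stdPDF (c n) * Real.exp (-(c n * η n) - η n ^ 2 / 2) := by
    rw [stdPDF_eq, stdPDF_eq, mul_assoc, ← Real.exp_add]
    congr 2
    ring
  have e2 : 1 + η n * (c n)⁻¹ = (c n + η n) / c n := by field_simp
  rw [e1, e2, inv_div]
  field_simp

/-- The thresholds grow slower than every power of `n`. -/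
lemma BonferroniThresholds.tendsto_sq_mul_rpow (h : BonferroniThresholds α c) (hα : 0 < α) {β : ℝ}
    (hβ : 0 < β) : Tendsto (fun n : ℕ ↦ c n ^ 2 * (n : ℝ) ^ (-β)) atTop (𝓝 0) := by
  have hc := h.tendsto_atTop
  have hn0 : Tendsto (fun n : ℕ ↦ (n : ℝ) ^ (-β)) atTop (𝓝 0) :=
    (tendsto_rpow_neg_atTop hβ).comp tendsto_natCast_atTop_atTop
  have hlog : Tendsto (fun n : ℕ ↦ Real.log n * (n : ℝ) ^ (-β)) atTop (𝓝 0) := by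
    have h1 := ((isLittleO_log_rpow_atTop hβ).tendsto_div_nhds_zero).comp
      (tendsto_natCast_atTop_atTop (R := ℝ))
    refine h1.congr fun n ↦ ?_
    simp [Real.rpow_neg, div_eq_mul_inv]
  -- `n φ(c_n) / c_n → α > 0` forces `c_n² ≤ 2 log n + O(1)`
  have hbound : ∀ᶠ n : ℕ in atTop, c n ^ 2 ≤ 2 * (Real.log n - Real.log (α / 2)) := by
    filter_upwards [hc.eventually_ge_atTop 1, eventually_gt_atTop 0,
      h.tendsto_stdPDF_div.eventually_const_lt (half_lt_self hα)] with n h1 h2 h3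
    have hn : (0 : ℝ) < n := by positivity
    have h4 : stdPDF (c n) / c n ≤ Real.exp (-(c n) ^ 2 / 2) := by
      rw [stdPDF_eq]
      have h5 : (√(2 * Real.pi))⁻¹ ≤ 1 := by
        refine inv_le_one_of_one_le₀ (Real.one_le_sqrt.2 ?_)
        linarith [Real.pi_gt_three]
      have h6 : (√(2 * Real.pi))⁻¹ * Real.exp (-(c n) ^ 2 / 2) ≤ Real.exp (-(c n) ^ 2 / 2) :=
        mul_le_of_le_one_left (Real.exp_pos _).le h5
      exact (div_le_self (by positivity) h1).trans h6
    have h7 : α / 2 ≤ n * Real.exp (-(c n) ^ 2 / 2) :=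
      h3.le.trans (mul_le_mul_of_nonneg_left h4 hn.le)
    have h8 := Real.log_le_log (half_pos hα) h7
    rw [Real.log_mul hn.ne' (Real.exp_pos _).ne', Real.log_exp] at h8
    linarith
  have hlim : Tendsto (fun n : ℕ ↦ 2 * (Real.log n - Real.log (α / 2)) * (n : ℝ) ^ (-β))
      atTop (𝓝 0) := by
    have := (hlog.sub (hn0.const_mul (Real.log (α / 2)))).const_mul 2
    simp only [mul_zero, sub_zero] at this
    exact this.congr fun n ↦ by ring
  refine squeeze_zero' (.of_forall fun n ↦ by positivity) ?_ hlim
  filter_upwards [hbound] with n hn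
  gcongr

end Thresholds

/-! ### Asymptotics of the orthant probability -/

section Orthant

lemma orthantProb_nonneg {ι : Type*} [Fintype ι] [DecidableEq ι] (S : Matrix ι ι ℝ) (c : ℝ) :
    0 ≤ orthantProb S c := measureReal_nonneg

lemma orthantProb_le_one {ι : Type*} [Fintype ι] [DecidableEq ι] (S : Matrix ι ι ℝ) (c : ℝ) :
    orthantProb S c ≤ 1 := measureReal_le_one

lemma fwer_eq_one_sub_orthantProb {n : ℕ} (S : Matrix (Fin n) (Fin n) ℝ) (c : ℝ) :
    fwer S c = 1 - orthantProb S c := by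
  have hm : MeasurableSet {x : EuclideanSpace ℝ (Fin n) | ∀ i, x i ≤ c} := by
    simpa using measurableSet_forall_le (X := fun k (x : EuclideanSpace ℝ (Fin n)) ↦ x k)
      (fun k ↦ by fun_prop) Finset.univ c
  rw [orthantProb, ← probReal_compl_eq_one_sub hm, fwer]
  congr 1
  ext x
  simp

lemma orthantProb_one (n : ℕ) (c : ℝ) :
    orthantProb (1 : Matrix (Fin n) (Fin n) ℝ) c = (1 - normalTail c) ^ n := by
  have hm : MeasurableSet {x : EuclideanSpace ℝ (Fin n) | ∀ i, x i ≤ c} := by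
    simpa using measurableSet_forall_le (X := fun k (x : EuclideanSpace ℝ (Fin n)) ↦ x k)
      (fun k ↦ by fun_prop) Finset.univ c
  have h1 : (gaussianReal 0 1).real (Set.Iic c) = 1 - normalTail c := by
    have e1 : (gaussianReal 0 1).real (Set.Ioi c) = normalTail c := by
      have e2 : (gaussianReal 0 1).real ((fun y ↦ -y) ⁻¹' Set.Iio (-c)) =
          (gaussianReal 0 1).real (Set.Iio (-c)) := by
        rw [← map_measureReal_apply measurable_neg measurableSet_Iio, gaussianReal_map_neg,
          neg_zero]
      have e3 : (fun y : ℝ ↦ -y) ⁻¹' Set.Iio (-c) = Set.Ioi c := by ext; simp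
      rw [← e3, e2, normalTail, cdf_eq_real]
      have := nullSingletonClass_gaussianReal (μ := 0) (v := 1) one_ne_zero
      exact measureReal_congr Iio_ae_eq_Iic
    rw [← e1, ← probReal_compl_eq_one_sub measurableSet_Ioi, Set.compl_Ioi]
  rw [orthantProb, multivariateGaussian_zero_one, ← map_pi_eq_stdGaussian,
    map_measureReal_apply (by fun_prop) hm]
  have h2 : WithLp.toLp 2 ⁻¹' {x : EuclideanSpace ℝ (Fin n) | ∀ i, x i ≤ c} =
      Set.univ.pi fun _ : Fin n ↦ Set.Iic c := by
    ext; simp [Pi.le_def]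
  rw [h2, measureReal_def, Measure.pi_pi, ENNReal.toReal_prod]
  simp only [← measureReal_def, h1, Finset.prod_const, Finset.card_univ, Fintype.card_fin]

lemma BonferroniThresholds.tendsto_orthantProb_one {α : ℝ} {c : ℕ → ℝ}
    (h : BonferroniThresholds α c) :
    Tendsto (fun n ↦ orthantProb (1 : Matrix (Fin n) (Fin n) ℝ) (c n)) atTop
      (𝓝 (Real.exp (-α))) := by
  have := Real.tendsto_one_add_pow_exp_of_tendsto (g := fun n ↦ -normalTail (c n)) (t := -α)
    (by simpa using h.tendsto_normalTail.neg)
  refine this.congr fun n ↦ ?_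
  rw [orthantProb_one, sub_eq_add_neg]

/-- A positive semidefinite matrix with unit diagonal and off-diagonal entries of absolute value
at most `u`. -/
structure IsCorrelationWithin {ι : Type*} (S : Matrix ι ι ℝ) (u : ℝ) : Prop where
  posSemidef : S.PosSemidef
  diag : ∀ i, S i i = 1
  abs_apply_le : ∀ i j, i ≠ j → |S i j| ≤ u

lemma IsCorrelationWithin.interp {ι : Type*} [Fintype ι] [DecidableEq ι] {S : Matrix ι ι ℝ}
    {u : ℝ} (h : IsCorrelationWithin S u) {t : ℝ} (ht : t ∈ Set.Ioo (0 : ℝ) 1) :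
    IsCorrelationWithin (interpMatrix S t) u where
  posSemidef := interpMatrix_posSemidef h.posSemidef ht.1.le ht.2.le
  diag i := interpMatrix_apply_self t (h.diag i)
  abs_apply_le i j hij := by
    rw [interpMatrix_apply_ne S t hij, abs_mul, abs_of_pos ht.1]
    exact (mul_le_of_le_one_left (abs_nonneg _) ht.2.le).trans (h.abs_apply_le i j hij)

/-- A crude form of the comparison inequality, from bounding the conditional probability in the pair
integrals trivially. It suffices for the limit of the orthant probability. -/
lemma IsCorrelationWithin.abs_orthantProb_sub_le {n : ℕ} {S : Matrix (Fin n) (Fin n) ℝ} {u c : ℝ}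
    (h : IsCorrelationWithin S u) (hu0 : 0 ≤ u) (hc : 1 ≤ c) (hu : u * c ^ 2 ≤ 1 / 4) :
    |orthantProb S c - orthantProb (1 : Matrix (Fin n) (Fin n) ℝ) c| ≤
      5 * Real.exp 2 / 2 * ((n * stdPDF c) ^ 2 * u) := by
  have key := _root_.abs_orthantProb_sub_le h.posSemidef h.diag (c := c) (κ := 0)
    (e := 5 * Real.exp 2 * stdPDF c ^ 2) ?_
  · rw [zero_div, zero_mul, sub_zero] at key
    refine key.trans ?_
    have hsum : ∑ i, ∑ j with j ≠ i, |S i j| ≤ (n : ℝ) ^ 2 * u := by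
      calc ∑ i, ∑ j with j ≠ i, |S i j| ≤ ∑ i : Fin n, ∑ j : Fin n, u := by
            refine Finset.sum_le_sum fun i _ ↦ ?_
            refine (Finset.sum_le_sum fun j hj ↦ h.abs_apply_le i j ?_).trans
              (Finset.sum_le_sum_of_subset_of_nonneg (Finset.filter_subset _ _) fun _ _ _ ↦ hu0)
            simpa using (Finset.mem_filter.1 hj).2.symm
        _ = (n : ℝ) ^ 2 * u := by simp; ring
    calc 5 * Real.exp 2 * stdPDF c ^ 2 / 2 * ∑ i, ∑ j with j ≠ i, |S i j|
        ≤ 5 * Real.exp 2 * stdPDF c ^ 2 / 2 * ((n : ℝ) ^ 2 * u) := by gcongr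
      _ = _ := by ring
  · filter_upwards [Ioo_mem_nhdsGT (by positivity : 0 < (4 * c)⁻¹)] with δ hδ t ht i j hij
    have hcδ : c * δ ≤ 1 / 4 := by
      have := (mul_lt_mul_of_pos_left hδ.2 (by linarith : 0 < c)).le
      rwa [mul_inv, mul_left_comm, mul_inv_cancel₀ (by linarith), mul_one, ← one_div] at this
    have hδc : δ ≤ c := by nlinarith [hδ.1]
    have hS := h.interp ht
    obtain ⟨h1, h2⟩ := pairIntegral_bounds hS.posSemidef hS.diag hS.abs_apply_le hc hδ.1 hδc hcδ
      hu le_rfl le_rfl hij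
    rw [show (8 : ℝ) * (1 / 4) = 2 by norm_num] at h1 h2
    have h3 : Real.exp (-2) ≤ Real.exp 2 := Real.exp_le_exp.2 (by norm_num)
    have h4 := sq_nonneg (stdPDF c)
    have hF1 := cdf_le_one (gaussianReal 0 1) (-c)
    rw [sub_zero, abs_le]
    constructor
    · have h6 := orthantProb_nonneg (interpMatrix S t) (c - (δ + 12 * u * c))
      have h7 : Real.exp (-2) * stdPDF c ^ 2 * (-4) ≤ Real.exp (-2) * stdPDF c ^ 2 *
          (orthantProb (interpMatrix S t) (c - (δ + 12 * u * c)) -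
            4 * cdf (gaussianReal 0 1) (-c)) := by
        gcongr
        linarith
      have h8 := mul_le_mul_of_nonneg_right h3 h4
      have h9 : 0 ≤ Real.exp (-2) * stdPDF c ^ 2 := by positivity
      linarith
    · have h6 := orthantProb_le_one (interpMatrix S t) (c + (δ + 12 * u * c))
      have h7 : Real.exp 2 * stdPDF c ^ 2 * (orthantProb (interpMatrix S t)
          (c + (δ + 12 * u * c)) + 4 * cdf (gaussianReal 0 1) (-c)) ≤
          Real.exp 2 * stdPDF c ^ 2 * 5 := by
        gcongr
        linarith
      linarith

/-- Convergence to the independent limit, uniformly over all weakly correlated matrices. The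
uniformity is needed along the whole segment of interpolating matrices. -/
lemma BonferroniThresholds.eventually_abs_orthantProb_sub_le {α : ℝ} {c u : ℕ → ℝ}
    (h : BonferroniThresholds α c) (hu0 : ∀ n, 0 ≤ u n)
    (hu : Tendsto (fun n ↦ u n * c n ^ 2) atTop (𝓝 0)) {ε : ℝ} (hε : 0 < ε) :
    ∀ᶠ n in atTop, ∀ S : Matrix (Fin n) (Fin n) ℝ, IsCorrelationWithin S (u n) →
      |orthantProb S (c n) - Real.exp (-α)| ≤ ε := by
  have hc := h.tendsto_atTop
  have hlim : Tendsto (fun n : ℕ ↦ 5 * Real.exp 2 / 2 * ((n * stdPDF (c n)) ^ 2 * u n)) atTop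
      (𝓝 0) := by
    have h1 := ((h.tendsto_stdPDF_div.pow 2).mul hu).const_mul (5 * Real.exp 2 / 2)
    rw [mul_zero, mul_zero] at h1
    refine h1.congr' ?_
    filter_upwards [hc.eventually_gt_atTop 0] with n hn
    field_simp
  filter_upwards [hlim.eventually_le_const (half_pos hε), hc.eventually_ge_atTop 1,
    hu.eventually_le_const (by norm_num : (0 : ℝ) < 1 / 4),
    (Metric.tendsto_nhds.1 h.tendsto_orthantProb_one) (ε / 2) (half_pos hε)] with n h1 h2 h3 h4 S hS
  rw [Real.dist_eq] at h4
  have h5 := hS.abs_orthantProb_sub_le (hu0 n) h2 h3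
  have h6 := abs_sub_le (orthantProb S (c n)) (orthantProb (1 : Matrix (Fin n) (Fin n) ℝ) (c n))
    (Real.exp (-α))
  linarith

/-- The normal comparison inequality with its sharp constant: to first order the change of the
orthant probability is `φ(c_n)² e^{-α} ∑_{i < j} ρ_ij`, with an error that is small relative to
`φ(c_n)² ∑_{i < j} |ρ_ij|`. -/
theorem BonferroniThresholds.eventually_abs_orthantProb_sub_one_le {α : ℝ} {c u : ℕ → ℝ}
    (h : BonferroniThresholds α c) (hα : 0 ≤ α) (hu0 : ∀ n, 0 ≤ u n)
    (hu : Tendsto (fun n ↦ u n * c n ^ 2) atTop (𝓝 0)) {ε : ℝ} (hε : 0 < ε) :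
    ∀ᶠ n in atTop, ∀ S : Matrix (Fin n) (Fin n) ℝ, IsCorrelationWithin S (u n) →
      |orthantProb S (c n) - orthantProb (1 : Matrix (Fin n) (Fin n) ℝ) (c n) -
          Real.exp (-α) * stdPDF (c n) ^ 2 / 2 * ∑ i, ∑ j with j ≠ i, S i j| ≤
        ε * stdPDF (c n) ^ 2 / 2 * ∑ i, ∑ j with j ≠ i, |S i j| := by
  have hc := h.tendsto_atTop
  set η : ℝ := min (ε / 5) 1 with hη
  have hη0 : 0 < η := by positivity
  have hη1 : η ≤ 1 := min_le_right _ _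
  have hη5 : 5 * η ≤ ε := by
    have : η ≤ ε / 5 := min_le_left _ _
    linarith
  -- `c_n δ` and `u_n c_n²` are at most `d n`, and the thresholds are perturbed by `13 d n / c_n`
  set d : ℕ → ℝ := fun n ↦ u n * c n ^ 2 + (c n)⁻¹ with hd
  have hd0 : Tendsto d atTop (𝓝 0) := by
    simpa using hu.add (tendsto_inv_atTop_zero.comp hc)
  set s : ℕ → ℝ := fun n ↦ 13 * d n / c n with hs
  have hcs : Tendsto (fun n ↦ c n * s n) atTop (𝓝 0) := by
    have h1 := hd0.const_mul 13
    rw [mul_zero] at h1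
    refine h1.congr' ?_
    filter_upwards [hc.eventually_gt_atTop 0] with n hn
    simp only [hs]
    field_simp
  have hus {σ : ℝ} : Tendsto (fun n ↦ u n * (c n + σ * s n) ^ 2) atTop (𝓝 0) := by
    have hs0 : Tendsto (fun n ↦ 1 + σ * (c n * s n) * ((c n)⁻¹ * (c n)⁻¹)) atTop (𝓝 1) := by
      have hi := tendsto_inv_atTop_zero.comp hc
      simpa using ((hcs.const_mul σ).mul (hi.mul hi)).const_add 1
    have h1 := hu.mul (hs0.pow 2)
    rw [zero_mul] at h1
    refine h1.congr' ?_
    filter_upwards [hc.eventually_gt_atTop 0] with n hn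
    field_simp
  have hplus := (h.add (η := fun n ↦ 1 * s n)
    (by simpa using hcs)).eventually_abs_orthantProb_sub_le hu0 hus hη0
  have hminus := (h.add (η := fun n ↦ -1 * s n)
    (by simpa using hcs.neg)).eventually_abs_orthantProb_sub_le hu0 hus hη0
  have hexp1 : ∀ᶠ n in atTop, Real.exp (8 * d n) ≤ 1 + η := by
    have h1 : Tendsto (fun n ↦ Real.exp (8 * d n)) atTop (𝓝 1) := by
      have := (Real.continuous_exp.tendsto _).comp (hd0.const_mul 8)
      simpa [Function.comp_def] using this
    exact h1.eventually_le_const (by linarith)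
  have hexp2 : ∀ᶠ n in atTop, 1 - η ≤ Real.exp (-(8 * d n)) := by
    have h1 : Tendsto (fun n ↦ Real.exp (-(8 * d n))) atTop (𝓝 1) := by
      have := (Real.continuous_exp.tendsto _).comp ((hd0.const_mul 8).neg)
      simpa [Function.comp_def] using this
    exact h1.eventually_const_le (by linarith)
  have hF : ∀ᶠ n in atTop, 4 * normalTail (c n) ≤ η := by
    have h1 := h.tendsto_normalTail_zero.const_mul 4
    rw [mul_zero] at h1
    exact h1.eventually_le_const hη0
  filter_upwards [hplus, hminus, hexp1, hexp2, hF, hc.eventually_ge_atTop 1,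
    hd0.eventually_le_const (by norm_num : (0 : ℝ) < 1 / 4)] with n hp hm he1 he2 hFn hc1 hd4 S hS
  have hc0 : 0 < c n := by linarith
  have huc0 : 0 ≤ u n * c n ^ 2 := mul_nonneg (hu0 n) (sq_nonneg _)
  have hd1 : u n * c n ^ 2 ≤ d n := le_add_of_nonneg_right (by positivity)
  have hdpos : 0 < d n := by
    have : 0 < (c n)⁻¹ := by positivity
    simp only [hd]
    linarith
  refine abs_orthantProb_sub_le hS.posSemidef hS.diag ?_
  filter_upwards [Ioo_mem_nhdsGT (div_pos hdpos hc0)] with δ hδ t ht i j hij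
  have hcδ : c n * δ ≤ d n := by
    have := hδ.2.le
    rwa [le_div_iff₀ hc0, mul_comm] at this
  have hδc : δ ≤ c n := by nlinarith [hδ.1]
  have hSt := hS.interp ht
  have hsn : δ + 12 * u n * c n ≤ s n := by
    have h1 : u n * c n ≤ d n / c n := by
      rw [le_div_iff₀ hc0]
      linarith [show u n * c n * c n = u n * c n ^ 2 by ring]
    have h2 : s n = d n / c n + 12 * (d n / c n) := by simp only [hs]; ring
    rw [h2]
    linarith [hδ.2]
  obtain ⟨h1, h2⟩ := pairIntegral_bounds hSt.posSemidef hSt.diag hSt.abs_apply_le hc1 hδ.1 hδc hcδ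
    hd1 hd4 hsn hij
  have hp' := (abs_le.1 (hp _ hSt)).2
  have hm' := (abs_le.1 (hm _ hSt)).1
  rw [one_mul] at hp'
  rw [neg_one_mul, ← sub_eq_add_neg] at hm'
  change _ ≤ _ * (_ + 4 * normalTail (c n)) at h2
  change _ * (_ - 4 * normalTail (c n)) ≤ _ at h1
  have hF0 := normalTail_nonneg (c n)
  have hφ : 0 ≤ stdPDF (c n) ^ 2 := sq_nonneg _
  have hα0 := Real.exp_pos (-α)
  set E := Real.exp (-α)
  have hO0 := orthantProb_nonneg (interpMatrix S t) (c n + s n)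
  have hE1 : orthantProb (interpMatrix S t) (c n + s n) + 4 * normalTail (c n) ≤ E + 2 * η := by
    linarith
  have hE2 : E - 2 * η ≤ orthantProb (interpMatrix S t) (c n - s n) - 4 * normalTail (c n) := by
    linarith
  have hE : E ≤ 1 := Real.exp_le_one_iff.2 (by linarith)
  rw [abs_le]
  constructor
  · set X := Real.exp (-(8 * d n))
    have hX0 : 0 ≤ X := (Real.exp_pos _).le
    have hX1 : X ≤ 1 := Real.exp_le_one_iff.2 (by linarith)
    have h3 : E - 3 * η ≤ X * (orthantProb (interpMatrix S t) (c n - s n) -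
        4 * normalTail (c n)) :=
      calc E - 3 * η ≤ X * (E - 2 * η) := by nlinarith
        _ ≤ _ := mul_le_mul_of_nonneg_left hE2 hX0
    have h4 := mul_le_mul_of_nonneg_right h3 hφ
    have h5 := mul_le_mul_of_nonneg_right hη5 hφ
    have h6 : 0 ≤ η * stdPDF (c n) ^ 2 := by positivity
    linarith
  · have h3 : Real.exp (8 * d n) * (orthantProb (interpMatrix S t) (c n + s n) +
        4 * normalTail (c n)) ≤ E + 5 * η :=
      calc _ ≤ (1 + η) * (E + 2 * η) := mul_le_mul he1 hE1 (by linarith) (by linarith)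
        _ ≤ _ := by nlinarith
    have h4 := mul_le_mul_of_nonneg_right h3 hφ
    have h5 := mul_le_mul_of_nonneg_right hη5 hφ
    linarith

end Orthant

/-! ### The alternating exponential series and the error rate -/

section ExpSeries

/-- The partial sum `∑_{j < m} (-x)^j / j!` of the series of `e^{-x}`. -/
noncomputable def expNegSum (m : ℕ) (x : ℝ) : ℝ :=
  ∑ j ∈ Finset.range m, (-x) ^ j / (j.factorial : ℝ)

lemma expNegSum_succ (m : ℕ) (x : ℝ) :
    expNegSum (m + 1) x = expNegSum m x + (-1) ^ m * (x ^ m / (m.factorial : ℝ)) := by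
  rw [expNegSum, Finset.sum_range_succ, expNegSum, neg_pow x m, mul_div_assoc]

lemma hasDerivAt_expNegSum_succ (m : ℕ) (x : ℝ) :
    HasDerivAt (expNegSum (m + 1)) (-expNegSum m x) x := by
  have h (j : ℕ) : HasDerivAt (fun x : ℝ ↦ (-x) ^ (j + 1) / ((j + 1).factorial : ℝ))
      (-((-x) ^ j / (j.factorial : ℝ))) x := by
    refine (((hasDerivAt_neg x).pow (j + 1)).div_const _).congr_deriv ?_
    have : (j.factorial : ℝ) ≠ 0 := by positivity
    rw [Nat.factorial_succ]
    push_cast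
    field_simp
  have hs : expNegSum (m + 1) = fun x ↦ ∑ j ∈ Finset.range m,
      (-x) ^ (j + 1) / ((j + 1).factorial : ℝ) + 1 := by
    ext y
    rw [expNegSum, Finset.sum_range_succ']
    simp
  rw [hs]
  refine ((HasDerivAt.fun_sum fun j _ ↦ h j).add_const 1).congr_deriv ?_
  rw [expNegSum, Finset.sum_neg_distrib]

/-- The remainders of the alternating exponential series have alternating signs. -/
lemma expNeg_remainder_pos (m : ℕ) {x : ℝ} (hx : 0 < x) :
    0 < (-1) ^ m * (Real.exp (-x) - expNegSum m x) := by
  induction m generalizing x with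
  | zero => simpa [expNegSum] using Real.exp_pos (-x)
  | succ m ih =>
    set f : ℝ → ℝ := fun y ↦ (-1) ^ (m + 1) * (Real.exp (-y) - expNegSum (m + 1) y) with hf
    have hder (y : ℝ) : HasDerivAt f ((-1) ^ m * (Real.exp (-y) - expNegSum m y)) y := by
      refine ((((hasDerivAt_neg y).exp).sub (hasDerivAt_expNegSum_succ m y)).const_mul
        ((-1) ^ (m + 1))).congr_deriv ?_
      ring
    have hmono : StrictMonoOn f (Set.Ici 0) := by
      refine strictMonoOn_of_deriv_pos (convex_Ici 0)
        (fun y _ ↦ (hder y).continuousAt.continuousWithinAt) fun y hy ↦ ?_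
      rw [interior_Ici] at hy
      rw [(hder y).deriv]
      exact ih hy
    have h0 : f 0 = 0 := by
      simp [hf, expNegSum, Finset.sum_range_succ']
    rw [← h0]
    exact hmono Set.self_mem_Ici hx.le hx

lemma abs_exp_neg_sub_expNegSum_lt (m : ℕ) {x : ℝ} (hx : 0 < x) :
    |Real.exp (-x) - expNegSum m x| < x ^ m / (m.factorial : ℝ) := by
  have h1 := expNeg_remainder_pos m hx
  have h2 := expNeg_remainder_pos (m + 1) hx
  have h3 : |Real.exp (-x) - expNegSum m x| = (-1) ^ m * (Real.exp (-x) - expNegSum m x) := by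
    rw [← abs_of_pos h1, abs_mul, abs_pow, abs_neg, abs_one, one_pow, one_mul]
  rw [expNegSum_succ] at h2
  have h4 : ((-1 : ℝ) ^ m) * (-1) ^ m = 1 := by rw [← mul_pow]; norm_num
  have h5 : (-1 : ℝ) ^ (m + 1) * (Real.exp (-x) - (expNegSum m x +
      (-1) ^ m * (x ^ m / (m.factorial : ℝ)))) = x ^ m / (m.factorial : ℝ) -
      (-1) ^ m * (Real.exp (-x) - expNegSum m x) := by
    rw [pow_succ]
    linear_combination (x ^ m / (m.factorial : ℝ)) * h4
  rw [h3]
  linarith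

lemma mainTerm_eq (α : ℝ) (K : ℕ) : mainTerm α K = 1 - expNegSum (K + 1) α := by
  rw [mainTerm, expNegSum, Finset.sum_range_succ', Finset.range_eq_Ico,
    Finset.sum_Ico_add' (fun j ↦ (-α) ^ j / (j.factorial : ℝ)) 0 K 1]
  simp only [pow_zero, Nat.factorial_zero, Nat.cast_one, div_one, zero_add, sub_add_cancel_right]
  rw [← Finset.sum_neg_distrib]
  refine Finset.sum_congr (by ext; simp) fun i hi ↦ ?_
  obtain ⟨j, rfl⟩ : ∃ j, i = j + 1 := ⟨i - 1, by have := (Finset.mem_Icc.1 hi).1; omega⟩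
  rw [neg_pow α, Nat.add_sub_cancel, pow_succ (-1 : ℝ)]
  ring

lemma correctionTerm_eq (α : ℝ) (K : ℕ) {n : ℕ} (S : Matrix (Fin n) (Fin n) ℝ) (c : ℝ) :
    correctionTerm α K S c = -(c ^ 2 * meanCorr S / 2 * (α ^ 2 * expNegSum (K - 1) α)) := by
  rw [correctionTerm, ← mul_neg]
  congr 1
  rw [expNegSum, Finset.mul_sum, ← Finset.sum_neg_distrib]
  refine Finset.sum_bij' (fun i _ ↦ i - 2) (fun j _ ↦ j + 2) ?_ ?_ ?_ ?_ ?_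
  · intro i hi
    simp only [Finset.mem_Icc, Finset.mem_range] at *
    omega
  · intro i hi
    simp only [Finset.mem_Icc, Finset.mem_range] at *
    omega
  · intro i hi
    simp only [Finset.mem_Icc] at *
    omega
  · intro i hi
    simp
  · intro i hi
    obtain ⟨j, rfl⟩ : ∃ j, i = j + 2 := ⟨i - 2, by have := (Finset.mem_Icc.1 hi).1; omega⟩
    have e1 : j + 2 - 1 = j + 1 := by omega
    rw [Nat.add_sub_cancel, e1, neg_pow α, pow_succ (-1 : ℝ)]
    ring

end ExpSeries

section Main

variable {α β : ℝ} {S : (n : ℕ) → Matrix (Fin n) (Fin n) ℝ} {c : ℕ → ℝ}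

lemma NearlyIndependent.exists_isCorrelationWithin (hS : NearlyIndependent β S) :
    ∃ C : ℝ, 0 ≤ C ∧ ∀ᶠ n : ℕ in atTop, IsCorrelationWithin (S n) (C * (n : ℝ) ^ (-β)) := by
  obtain ⟨C, hC⟩ := hS.isBigO
  refine ⟨|C|, abs_nonneg C, ?_⟩
  filter_upwards [hC] with n hn
  refine ⟨(hS.isCorrelationMatrix n).posSemidef, (hS.isCorrelationMatrix n).diag_eq_one,
    fun i j hij ↦ (hn i j hij).trans ?_⟩
  exact mul_le_mul_of_nonneg_right (le_abs_self C) (by positivity)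

lemma sum_offDiag_eq_meanCorr {n : ℕ} (hn : 2 ≤ n) (A : Matrix (Fin n) (Fin n) ℝ) :
    ∑ i, ∑ j with j ≠ i, A i j = (n : ℝ) * ((n : ℝ) - 1) * meanCorr A := by
  have h2 : (2 : ℝ) ≤ n := by exact_mod_cast hn
  rw [meanCorr, mul_div_cancel₀]
  exact mul_ne_zero (by linarith) (by linarith)

lemma sum_offDiag_eq_meanAbsCorr {n : ℕ} (hn : 2 ≤ n) (A : Matrix (Fin n) (Fin n) ℝ) :
    ∑ i, ∑ j with j ≠ i, |A i j| = (n : ℝ) * ((n : ℝ) - 1) * meanAbsCorr A := by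
  have h2 : (2 : ℝ) ≤ n := by exact_mod_cast hn
  rw [meanAbsCorr, mul_div_cancel₀]
  exact mul_ne_zero (by linarith) (by linarith)

lemma abs_meanCorr_le {n : ℕ} (hn : 2 ≤ n) (A : Matrix (Fin n) (Fin n) ℝ) :
    |meanCorr A| ≤ meanAbsCorr A := by
  have h2 : (2 : ℝ) ≤ n := by exact_mod_cast hn
  have h3 : 0 < (n : ℝ) * ((n : ℝ) - 1) := mul_pos (by linarith) (by linarith)
  rw [meanCorr, meanAbsCorr, abs_div, abs_of_pos h3]
  gcongr
  exact (Finset.abs_sum_le_sum_abs _ _).trans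
    (Finset.sum_le_sum fun i _ ↦ Finset.abs_sum_le_sum_abs _ _)

lemma IsCorrelationWithin.meanAbsCorr_le {n : ℕ} (hn : 2 ≤ n) {A : Matrix (Fin n) (Fin n) ℝ}
    {u : ℝ} (h : IsCorrelationWithin A u) : meanAbsCorr A ≤ u := by
  have h2 : (2 : ℝ) ≤ n := by exact_mod_cast hn
  have h3 : 0 < (n : ℝ) * ((n : ℝ) - 1) := mul_pos (by linarith) (by linarith)
  rw [meanAbsCorr, div_le_iff₀ h3]
  calc ∑ i, ∑ j with j ≠ i, |A i j| ≤ ∑ i : Fin n, ∑ j with j ≠ i, u :=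
        Finset.sum_le_sum fun i _ ↦ Finset.sum_le_sum fun j hj ↦
          h.abs_apply_le i j (by simpa using (Finset.mem_filter.1 hj).2.symm)
    _ = u * ((n : ℝ) * ((n : ℝ) - 1)) := by
        have (i : Fin n) : (Finset.univ.filter fun j ↦ j ≠ i).card = n - 1 := by
          rw [Finset.filter_ne' Finset.univ i, Finset.card_erase_of_mem (Finset.mem_univ i)]
          simp
        simp only [Finset.sum_const, this, nsmul_eq_mul, Finset.card_univ, Fintype.card_fin]
        rw [Nat.cast_sub (by omega)]
        push_cast
        ring

lemma tendsto_correctionTerm_zero (hα : 0 < α) (hβ : 0 < β) (hS : NearlyIndependent β S)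
    (hc : BonferroniThresholds α c) (K : ℕ) :
    Tendsto (fun n ↦ correctionTerm α K (S n) (c n)) atTop (𝓝 0) := by
  obtain ⟨C, hC0, hC⟩ := hS.exists_isCorrelationWithin
  have hlim := (hc.tendsto_sq_mul_rpow hα hβ).const_mul C
  rw [mul_zero] at hlim
  have h1 : Tendsto (fun n ↦ c n ^ 2 * meanCorr (S n)) atTop (𝓝 0) := by
    refine squeeze_zero_norm' ?_ hlim
    filter_upwards [hC, eventually_ge_atTop 2] with n hn h2
    rw [norm_mul, Real.norm_eq_abs, Real.norm_eq_abs, abs_of_nonneg (sq_nonneg _), mul_left_comm]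
    exact mul_le_mul_of_nonneg_left ((abs_meanCorr_le h2 _).trans (hn.meanAbsCorr_le h2))
      (sq_nonneg _)
  have h2 := (((h1.div_const 2).mul_const (α ^ 2 * expNegSum (K - 1) α))).neg
  rw [zero_div, zero_mul, neg_zero] at h2
  exact h2.congr fun n ↦ (correctionTerm_eq α K (S n) (c n)).symm

lemma tendsto_fwer (hα : 0 < α) (hβ : 0 < β) (hS : NearlyIndependent β S)
    (hc : BonferroniThresholds α c) :
    Tendsto (fun n ↦ fwer (S n) (c n)) atTop (𝓝 (1 - Real.exp (-α))) := by
  obtain ⟨C, hC0, hC⟩ := hS.exists_isCorrelationWithin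
  have hlim := (hc.tendsto_sq_mul_rpow hα hβ).const_mul C
  rw [mul_zero] at hlim
  rw [Metric.tendsto_nhds]
  intro ε hε
  have h := hc.eventually_abs_orthantProb_sub_le (u := fun n : ℕ ↦ C * (n : ℝ) ^ (-β))
    (fun n ↦ by positivity) (hlim.congr fun n ↦ by ring) (half_pos hε)
  filter_upwards [h, hC] with n h1 h2
  rw [Real.dist_eq, fwer_eq_one_sub_orthantProb, sub_sub_sub_cancel_left, abs_sub_comm]
  exact (h1 _ h2).trans_lt (half_lt_self hε)

lemma tendsto_fwer_sub (hα : 0 < α) (hβ : 0 < β) (hS : NearlyIndependent β S)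
    (hc : BonferroniThresholds α c) (K : ℕ) :
    Tendsto (fun n ↦ fwer (S n) (c n) - (mainTerm α K + correctionTerm α K (S n) (c n))) atTop
      (𝓝 (1 - Real.exp (-α) - mainTerm α K)) := by
  have := (tendsto_fwer hα hβ hS hc).sub
    ((tendsto_correctionTerm_zero hα hβ hS hc K).const_add (mainTerm α K))
  simpa using this

/-- The deviation from independence is `-(c_n² / 2) α² e^{-α} ρ̄_n` up to a relative error `o(1)`,
and the correction term replaces `e^{-α}` by a partial sum of its series. -/
lemma eventually_abs_fwer_sub_fwer_one_sub_le (hα : 0 < α) (hβ : 0 < β)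
    (hS : NearlyIndependent β S) (hc : BonferroniThresholds α c) {K : ℕ} (hK : 1 ≤ K) :
    ∀ᶠ n : ℕ in atTop,
      |fwer (S n) (c n) - fwer (1 : Matrix (Fin n) (Fin n) ℝ) (c n)
          - correctionTerm α K (S n) (c n)| ≤
        (c n) ^ 2 * meanAbsCorr (S n) / 2 * (α ^ (K + 1) / ((K - 1).factorial : ℝ)) := by
  obtain ⟨C, hC0, hC⟩ := hS.exists_isCorrelationWithin
  have hlim := (hc.tendsto_sq_mul_rpow hα hβ).const_mul C
  rw [mul_zero] at hlim
  set E := Real.exp (-α)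
  set T := expNegSum (K - 1) α
  set b := α ^ (K + 1) / ((K - 1).factorial : ℝ) with hb
  have hgap : α ^ 2 * |E - T| < b := by
    have h1 := mul_lt_mul_of_pos_left (abs_exp_neg_sub_expNegSum_lt (K - 1) hα) (pow_pos hα 2)
    refine h1.trans_eq ?_
    rw [hb, ← mul_div_assoc, ← pow_add, show 2 + (K - 1) = K + 1 by omega]
  -- the strict inequality for the series remainder leaves room for the error of the comparison
  set ε := (b - α ^ 2 * |E - T|) / (2 * α ^ 2) with hε
  have hε0 : 0 < ε := div_pos (sub_pos.2 hgap) (by positivity)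
  -- `A n c_n²` is the number of ordered pairs times `φ(c_n)²`
  set A : ℕ → ℝ := fun n ↦ (n : ℝ) * ((n : ℝ) - 1) * stdPDF (c n) ^ 2 / c n ^ 2 with hA
  have hcc := hc.tendsto_atTop
  have hAlim : Tendsto A atTop (𝓝 (α ^ 2)) := by
    have h1 : Tendsto (fun n : ℕ ↦ 1 - (n : ℝ)⁻¹) atTop (𝓝 1) := by
      simpa using (tendsto_inv_atTop_zero.comp (tendsto_natCast_atTop_atTop (R := ℝ))).const_sub 1
    have h2 := (hc.tendsto_stdPDF_div.pow 2).mul h1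
    rw [mul_one] at h2
    refine h2.congr' ?_
    filter_upwards [eventually_gt_atTop 0] with n hn
    have : (n : ℝ) ≠ 0 := by positivity
    simp only [hA]
    field_simp
  have hbound : ∀ᶠ n in atTop, |A n * E - α ^ 2 * T| + ε * A n ≤ b := by
    have h1 := ((hAlim.mul_const E).sub_const (α ^ 2 * T)).abs.add (hAlim.const_mul ε)
    refine h1.eventually_le_const ?_
    rw [← mul_sub, abs_mul, abs_of_pos (pow_pos hα 2)]
    have h2 : ε * α ^ 2 = (b - α ^ 2 * |E - T|) / 2 := by
      rw [hε]; field_simp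
    linarith
  have hcomp := hc.eventually_abs_orthantProb_sub_one_le (u := fun n : ℕ ↦ C * (n : ℝ) ^ (-β))
    hα.le (fun n ↦ by positivity) (hlim.congr fun n ↦ by ring) hε0
  filter_upwards [hcomp, hC, hbound, eventually_ge_atTop 2, hcc.eventually_gt_atTop 0]
    with n h1 h2 h3 h4 h5
  have hm := abs_meanCorr_le h4 (S n)
  have h6 := h1 _ h2
  rw [sum_offDiag_eq_meanCorr h4, sum_offDiag_eq_meanAbsCorr h4] at h6
  rw [fwer_eq_one_sub_orthantProb, fwer_eq_one_sub_orthantProb, correctionTerm_eq]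
  set P := orthantProb (S n) (c n)
  set P₁ := orthantProb (1 : Matrix (Fin n) (Fin n) ℝ) (c n)
  set ρ := meanCorr (S n)
  set m := meanAbsCorr (S n)
  have hAn : (n : ℝ) * ((n : ℝ) - 1) * stdPDF (c n) ^ 2 = A n * c n ^ 2 := by
    simp only [hA]
    field_simp
  have e1 : E * stdPDF (c n) ^ 2 / 2 * ((n : ℝ) * ((n : ℝ) - 1) * ρ) =
      c n ^ 2 / 2 * (A n * E * ρ) := by linear_combination (E * ρ / 2) * hAn
  have e2 : ε * stdPDF (c n) ^ 2 / 2 * ((n : ℝ) * ((n : ℝ) - 1) * m) =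
      c n ^ 2 / 2 * (ε * A n * m) := by linear_combination (ε * m / 2) * hAn
  rw [e1, e2] at h6
  have e3 : 1 - P - (1 - P₁) - -(c n ^ 2 * ρ / 2 * (α ^ 2 * T)) =
      -(P - P₁ - c n ^ 2 / 2 * (A n * E * ρ)) - c n ^ 2 / 2 * ((A n * E - α ^ 2 * T) * ρ) := by ring
  rw [e3]
  refine (abs_sub _ _).trans ?_
  rw [abs_neg, abs_mul, abs_of_nonneg (by positivity : 0 ≤ c n ^ 2 / 2), abs_mul]
  have hm0 : 0 ≤ m := (abs_nonneg _).trans hm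
  calc _ ≤ c n ^ 2 / 2 * (ε * A n * m) + c n ^ 2 / 2 * (|A n * E - α ^ 2 * T| * m) := by gcongr
    _ = c n ^ 2 / 2 * m * (|A n * E - α ^ 2 * T| + ε * A n) := by ring
    _ ≤ c n ^ 2 / 2 * m * b := by gcongr
    _ = c n ^ 2 * m / 2 * b := by ring

end Main

theorem theorem4p1 (α : ℝ) (hα : 0 < α) :
    (∀ ε : ℝ, 0 < ε → ∃ K₀ : ℕ, ∀ K : ℕ, K₀ ≤ K →
      ∀ (β : ℝ) (S : (n : ℕ) → Matrix (Fin n) (Fin n) ℝ) (c : ℕ → ℝ),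
        0 < β → NearlyIndependent β S → BonferroniThresholds α c →
        ∀ᶠ n : ℕ in atTop,
          |fwer (S n) (c n) / (mainTerm α K + correctionTerm α K (S n) (c n)) - 1| ≤ ε) ∧
    (∀ K : ℕ, 1 ≤ K →
      ∀ (β : ℝ) (S : (n : ℕ) → Matrix (Fin n) (Fin n) ℝ) (c : ℕ → ℝ),
        0 < β → NearlyIndependent β S → BonferroniThresholds α c →
        ∀ᶠ n : ℕ in atTop,
          |fwer (S n) (c n) - (mainTerm α K + correctionTerm α K (S n) (c n))|
              ≤ α ^ (K + 1) / ((K + 1).factorial : ℝ) ∧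
          |fwer (S n) (c n) - fwer (1 : Matrix (Fin n) (Fin n) ℝ) (c n)
              - correctionTerm α K (S n) (c n)|
              ≤ (c n) ^ 2 * meanAbsCorr (S n) / 2 *
                (α ^ (K + 1) / ((K - 1).factorial : ℝ))) := by
  have hrem (K : ℕ) : |1 - Real.exp (-α) - mainTerm α K| <
      α ^ (K + 1) / ((K + 1).factorial : ℝ) := by
    rw [mainTerm_eq, sub_sub_sub_cancel_left, abs_sub_comm]
    exact abs_exp_neg_sub_expNegSum_lt (K + 1) hα
  constructor
  · intro ε hε
    have hp : 0 < 1 - Real.exp (-α) := sub_pos.2 (Real.exp_lt_one_iff.2 (by linarith))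
    have hM : Tendsto (fun K ↦ mainTerm α K) atTop (𝓝 (1 - Real.exp (-α))) := by
      have h1 : Tendsto (fun K : ℕ ↦ α ^ (K + 1) / ((K + 1).factorial : ℝ)) atTop (𝓝 0) :=
        (FloorSemiring.tendsto_pow_div_factorial_atTop α).comp (tendsto_add_atTop_nat 1)
      rw [tendsto_iff_dist_tendsto_zero]
      refine squeeze_zero (fun _ ↦ dist_nonneg) (fun K ↦ ?_) h1
      rw [Real.dist_eq, abs_sub_comm]
      exact (hrem K).le
    have hq : Tendsto (fun K ↦ |(1 - Real.exp (-α)) / mainTerm α K - 1|) atTop (𝓝 0) := by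
      have := (((tendsto_const_nhds (x := 1 - Real.exp (-α))).div hM hp.ne').sub_const 1).abs
      simpa [div_self hp.ne'] using this
    obtain ⟨K₀, hK₀⟩ := eventually_atTop.1
      ((hq.eventually_lt_const hε).and (hM.eventually_const_lt hp))
    refine ⟨K₀, fun K hK β S c hβ hS hc ↦ ?_⟩
    obtain ⟨h1, h2⟩ := hK₀ K hK
    have h3 : Tendsto (fun n ↦ |fwer (S n) (c n) /
        (mainTerm α K + correctionTerm α K (S n) (c n)) - 1|) atTop
        (𝓝 |(1 - Real.exp (-α)) / mainTerm α K - 1|) := by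
      have h4 := (tendsto_correctionTerm_zero hα hβ hS hc K).const_add (mainTerm α K)
      rw [add_zero] at h4
      exact (((tendsto_fwer hα hβ hS hc).div h4 h2.ne').sub_const 1).abs
    exact h3.eventually_le_const h1
  · intro K hK β S c hβ hS hc
    exact ((tendsto_fwer_sub hα hβ hS hc K).abs.eventually_le_const (hrem K)).and
      (eventually_abs_fwer_sub_fwer_one_sub_le hα hβ hS hc hK)
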